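/- **Setting.** Let $d,m\ge 0$ be integers, let $|\cdot|$ be the Euclidean norm, let $\mathcal P(\mathbb R^d)$ be the set of Borel probability measures on $\mathbb R^d$, and let $\mathcal P_1(\mathbb R^d)$ be the set of those with $\int|x|\,\mu(dx)<\infty$. Let $$\mathcal W_1(\mu,\nu)=\inf\{E|X-Y| : \mathcal L(X)=\mu,\ \mathcal L(Y)=\nu\}$$ be the Wasserstein-1 distance. Let $A$ be a real $d\times d$ matrix with operator norm $\|A\|$ for $|\cdot|$, let $\delta>0$, let $\theta$ be a Borel probability measure on $\mathbb R^m$, let $\mu_0\in\mathcal P(\mathbb R^d)$, and let $f:\mathbb R^d\times\mathcal P(\mathbb R^d)\times\mathbb R^m\to\mathbb R^d$ be measurable. For every $N\ge 1$ consider on some probability space an $N$-particle system $X_n^i=X_n^{i,N}$, $i=1,\dots,N$, $n\ge 0$, with $$X_{n+1}^i=AX_n^i+\delta f(X_n^i,\mu_n^N,\epsilon_{n+1}^i),\qquad \mu_n^N=\frac1N\sum_{i=1}^N\delta_{X_n^i}.$$ Here $X_0^1,\dots,X_0^N$ are exchangeable with common law $\mu_0$ (the same for all $N$), the noises $\epsilon_n^i$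 ($n\ge 1$, $1\le i\le N$) are i.i.d. with law $\theta$, and the noises are independent of $(X_0^1,\dots,X_0^N)$. For $\mu\in\mathcal P_1(\mathbb R^d)$ let $\Psi(\mu)$ be the law of $AX+\delta f(X,\mu,\epsilon)$ with $(X,\epsilon)\sim\mu\otimes\theta$; a fixed point of $\Psi$ is a $\mu\in\mathcal P_1(\mathbb R^d)$ with $\Psi(\mu)=\mu$. Put $$D(z)=\sup\left\{\frac{|f(x_1,\mu_1,z)-f(x_2,\mu_2,z)|}{|x_1-x_2|+\mathcal W_1(\mu_1,\mu_2)} : x_1\ne x_2\in\mathbb R^d,\ \mu_1\ne\mu_2\in\mathcal P_1(\mathbb R^d)\right\},$$ $D_1(z)=|f(0,\delta_0,z)|$, and $\sigma=\int D\,d\theta$. **Statement.** Assume that * $\|A\|\le e^{-\omega}$ for some $\omega>0$; * for some $\alpha>0$, $\int|x|^{1+\alpha}\mu_0(dx)<\infty$, $\int D(z)^{1+\alpha}\theta(dz)<\infty$ and $\int D_1(z)^{1+\alpha}\theta(dz)<\infty$; * $0<\delta<a_0:=\dfrac{1-e^{-\omega}}{2\sigma}$ (with $a_0=\infty$ if $\sigma=0$).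 Then $\Psi$ has a unique fixed point $\mu_\infty$ in $\mathcal P_1(\mathbb R^d)$, and $$\limsup_{N\to\infty}\limsup_{n\to\infty}E\,\mathcal W_1(\mu_n^N,\mu_\infty)=\limsup_{n\to\infty}\limsup_{N\to\infty}E\,\mathcal W_1(\mu_n^N,\mu_\infty)=0.$$ -/

import Mathlib

open MeasureTheory ProbabilityTheory Filter
open scoped ENNReal

/-- `ℝᵈ` with the Euclidean norm. -/
abbrev Euc (d : ℕ) : Type := EuclideanSpace ℝ (Fin d)

/-- The Wasserstein-1 distance: the infimum of `E|X - Y|` over all couplings `(X, Y)` of `μ` and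
`ν`, a coupling being given by its joint law `π`. -/
noncomputable def wasserstein1 {d : ℕ} (μ ν : Measure (Euc d)) : ℝ≥0∞ :=
  ⨅ (π : Measure (Euc d × Euc d)) (_ : π.map Prod.fst = μ) (_ : π.map Prod.snd = ν),
    ∫⁻ p, edist p.1 p.2 ∂π

/-- `μ ∈ 𝒫₁(ℝᵈ)`: the probability measure `μ` has a finite first moment. -/
def HasFirstMoment {d : ℕ} (μ : ProbabilityMeasure (Euc d)) : Prop :=
  ∫⁻ x, ‖x‖ₑ ∂(μ : Measure (Euc d)) < ∞

/-- The empirical measure `N⁻¹ ∑ᵢ δ_{xᵢ}` of the points `x₁, …, x_N`, as a measure. -/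
noncomputable def empiricalAux {d : ℕ} (N : ℕ+) (x : Fin N → Euc d) : Measure (Euc d) :=
  ((N : ℕ) : ℝ≥0∞)⁻¹ • ∑ i, Measure.dirac (x i)

theorem isProbabilityMeasure_empiricalAux {d : ℕ} (N : ℕ+) (x : Fin N → Euc d) :
    IsProbabilityMeasure (empiricalAux N x) := by
  constructor
  have h : ((N : ℕ) : ℝ≥0∞) ≠ 0 := by exact_mod_cast N.ne_zero
  simp [empiricalAux, ENNReal.inv_mul_cancel h (ENNReal.natCast_ne_top _)]

/-- The empirical measure `N⁻¹ ∑ᵢ δ_{xᵢ}`, as a probability measure. -/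
noncomputable def empirical {d : ℕ} (N : ℕ+) (x : Fin N → Euc d) : ProbabilityMeasure (Euc d) :=
  ⟨empiricalAux N x, isProbabilityMeasure_empiricalAux N x⟩

/-- One step of the dynamics: `A x + δ f(x, μ, z)`. -/
noncomputable def stepMap {d m : ℕ} (A : Matrix (Fin d) (Fin d) ℝ) (δ : ℝ)
    (f : Euc d → ProbabilityMeasure (Euc d) → Euc m → Euc d)
    (x : Euc d) (μ : ProbabilityMeasure (Euc d)) (z : Euc m) : Euc d :=
  Matrix.toEuclideanCLM (𝕜 := ℝ) A x + δ • f x μ z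

/-- The transition probability `P^ρ(x, ·)`: the law of `A x + δ f(x, ρ, z)` for `z ∼ θ`. -/
noncomputable def transition {d m : ℕ} (A : Matrix (Fin d) (Fin d) ℝ) (δ : ℝ)
    (f : Euc d → ProbabilityMeasure (Euc d) → Euc m → Euc d) (θ : ProbabilityMeasure (Euc m))
    (ρ : ProbabilityMeasure (Euc d)) (x : Euc d) : Measure (Euc d) :=
  (θ : Measure (Euc m)).map (stepMap A δ f x ρ)

/-- `Ψ(μ) = μ P^μ`, that is `Ψ(μ)(C) = ∫ P^μ(x, C) μ(dx)`. -/
noncomputable def nonlinearMap {d m : ℕ} (A : Matrix (Fin d) (Fin d) ℝ) (δ : ℝ)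
    (f : Euc d → ProbabilityMeasure (Euc d) → Euc m → Euc d) (θ : ProbabilityMeasure (Euc m))
    (μ : ProbabilityMeasure (Euc d)) : Measure (Euc d) :=
  (μ : Measure (Euc d)).bind (transition A δ f θ μ)

/-- `μ ∈ 𝒫₁(ℝᵈ)` is a fixed point of the evolution `μ ↦ Ψ(μ)`. -/
def IsFixedLaw {d m : ℕ} (A : Matrix (Fin d) (Fin d) ℝ) (δ : ℝ)
    (f : Euc d → ProbabilityMeasure (Euc d) → Euc m → Euc d) (θ : ProbabilityMeasure (Euc m))
    (μ : ProbabilityMeasure (Euc d)) : Prop :=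
  HasFirstMoment μ ∧ nonlinearMap A δ f θ μ = (μ : Measure (Euc d))

/-- `D(z)`, the supremum of `|f(x₁,μ₁,z) - f(x₂,μ₂,z)| / (|x₁ - x₂| + W₁(μ₁,μ₂))` over
`x₁ ≠ x₂` in `ℝᵈ` and `μ₁ ≠ μ₂` in `𝒫₁(ℝᵈ)`. -/
noncomputable def lipBound {d m : ℕ} (f : Euc d → ProbabilityMeasure (Euc d) → Euc m → Euc d)
    (z : Euc m) : ℝ≥0∞ :=
  ⨆ (x₁ : Euc d) (x₂ : Euc d) (μ₁ : ProbabilityMeasure (Euc d)) (μ₂ : ProbabilityMeasure (Euc d))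
    (_ : x₁ ≠ x₂) (_ : μ₁ ≠ μ₂) (_ : HasFirstMoment μ₁) (_ : HasFirstMoment μ₂),
    ‖f x₁ μ₁ z - f x₂ μ₂ z‖ₑ /
      (edist x₁ x₂ + wasserstein1 (μ₁ : Measure (Euc d)) (μ₂ : Measure (Euc d)))

/-- The Dirac mass at the origin. -/
noncomputable def diracZero (d : ℕ) : ProbabilityMeasure (Euc d) :=
  ⟨Measure.dirac 0, inferInstance⟩

/-- `D₁(z) = |f(0, δ₀, z)|`. -/
noncomputable def originBound {d m : ℕ} (f : Euc d → ProbabilityMeasure (Euc d) → Euc m → Euc d)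
    (z : Euc m) : ℝ≥0∞ :=
  ‖f 0 (diracZero d) z‖ₑ

/-- The threshold `a₀ = (1 - e^{-ω}) / (2σ)` with `σ = ∫ D dθ`; it is `∞` if `σ = 0`. -/
noncomputable def threshold {d m : ℕ} (f : Euc d → ProbabilityMeasure (Euc d) → Euc m → Euc d)
    (θ : ProbabilityMeasure (Euc m)) (ω : ℝ) : ℝ≥0∞ :=
  ENNReal.ofReal (1 - Real.exp (-ω)) / (2 * ∫⁻ z, lipBound f z ∂(θ : Measure (Euc m)))

/-- The system of `N` weakly interacting particles on the probability space `(Ω, P)`: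
`X n i` is the state of particle `i` at time `n`, and `ε n i` is the noise that drives it from
time `n` to time `n + 1`. -/
structure IsParticleSystem {d m : ℕ} (A : Matrix (Fin d) (Fin d) ℝ) (δ : ℝ)
    (f : Euc d → ProbabilityMeasure (Euc d) → Euc m → Euc d) (θ : ProbabilityMeasure (Euc m))
    (μ₀ : ProbabilityMeasure (Euc d)) (N : ℕ+) {Ω : Type*} [MeasurableSpace Ω] (P : Measure Ω)
    (X : ℕ → Fin N → Ω → Euc d) (ε : ℕ → Fin N → Ω → Euc m) : Prop where
  measurable_init : ∀ i, Measurable (X 0 i)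
  law_init : ∀ i, P.map (X 0 i) = (μ₀ : Measure (Euc d))
  exchangeable_init : ∀ τ : Equiv.Perm (Fin N),
    P.map (fun w i => X 0 (τ i) w) = P.map (fun w i => X 0 i w)
  measurable_noise : ∀ n i, Measurable (ε n i)
  law_noise : ∀ n i, P.map (ε n i) = (θ : Measure (Euc m))
  indep_noise : iIndepFun (fun (p : ℕ × Fin N) => ε p.1 p.2) P
  indep_init_noise : IndepFun (fun w i => X 0 i w) (fun w (p : ℕ × Fin N) => ε p.1 p.2 w) P
  step : ∀ n i w, X (n + 1) i w = stepMap A δ f (X n i w) (empirical N (fun j => X n j w)) (ε n i w)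

/-- `E W₁(μ_n^N, ν)` where `μ_n^N` is the empirical measure of the particles at time `n`. -/
noncomputable def meanDist {d : ℕ} {N : ℕ+} {Ω : Type*} [MeasurableSpace Ω] (P : Measure Ω)
    (X : ℕ → Fin N → Ω → Euc d) (n : ℕ) (ν : ProbabilityMeasure (Euc d)) : ℝ≥0∞ :=
  ∫⁻ w, wasserstein1 (empirical N (fun i => X n i w) : Measure (Euc d)) (ν : Measure (Euc d)) ∂P

/-! ### Couplings and the Wasserstein distance. -/

section Wasserstein

variable {d : ℕ}

/-! Everything rests on synchronous coupling: two copies driven by the same noise approach each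
other in mean. With `a = e^{-ω} + δσ` and `b = δσ`, one step costs at most `a` times the distance of
the states plus `b` times the distance of the laws, and the threshold on `δ` says exactly that `a +
b < 1` (`isMeanContraction_stepMap`).

Uniqueness of the fixed point follows because `Ψ` contracts the Wasserstein distance by `a + b`.
Existence avoids completeness of the space of measures. A law is represented by a random variable
`Z` on the space of noise sequences, and `Ψ` lifts to the map sending `Z` to `G(Z(e₁, e₂, …), law Z,
e₀)`. This map contracts `L¹`, so Banach's theorem applies there (`exists_next_eq`).

For the particles, take `N` independent copies of the stationary nonlinear process and feed them the
particles' noises (`exists_coupling_step`). The mean over `i` of the expected distances obeys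
`Δ_{n+1} ≤ (a + b) Δ_n + b β_N`, where `β_N` is the expected distance between the fixed point and
the empirical measure of an i.i.d. sample from it. Hence `E W₁ ≤ (a + b)ⁿ K + C β_N` with `K`, `C`
independent of `n` and `N` (`meanDist_le`). Since `β_N → 0` by a law of large numbers
(`tendsto_lintegral_wasserstein1_empirical`), both iterated limits vanish. -/

theorem wasserstein1_le_lintegral (π : Measure (Euc d × Euc d)) :
    wasserstein1 (π.map Prod.fst) (π.map Prod.snd) ≤ ∫⁻ p, edist p.1 p.2 ∂π :=
  iInf_le_of_le π (iInf_le_of_le rfl (iInf_le_of_le rfl le_rfl))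

theorem exists_coupling_of_wasserstein1_lt {μ ν : Measure (Euc d)} {c : ℝ≥0∞}
    (h : wasserstein1 μ ν < c) :
    ∃ π : Measure (Euc d × Euc d), π.map Prod.fst = μ ∧ π.map Prod.snd = ν ∧
      ∫⁻ p, edist p.1 p.2 ∂π < c := by
  simp only [wasserstein1, iInf_lt_iff] at h
  obtain ⟨π, h₁, h₂, h₃⟩ := h
  exact ⟨π, h₁, h₂, h₃⟩

theorem wasserstein1_map_map_le {Ω : Type*} [MeasurableSpace Ω] (P : Measure Ω)
    {X Y : Ω → Euc d} (hX : Measurable X) (hY : Measurable Y) :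
    wasserstein1 (P.map X) (P.map Y) ≤ ∫⁻ w, edist (X w) (Y w) ∂P := by
  have h := wasserstein1_le_lintegral (P.map fun w => (X w, Y w))
  rwa [Measure.map_map measurable_fst (hX.prodMk hY), Measure.map_map measurable_snd (hX.prodMk hY),
    lintegral_map (by fun_prop) (hX.prodMk hY)] at h

theorem wasserstein1_self (μ : Measure (Euc d)) : wasserstein1 μ μ = 0 := by
  have h := wasserstein1_map_map_le μ (X := id) (Y := id) measurable_id measurable_id
  simpa using h

theorem wasserstein1_comm (μ ν : Measure (Euc d)) : wasserstein1 μ ν = wasserstein1 ν μ := by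
  have key : ∀ μ ν : Measure (Euc d), wasserstein1 μ ν ≤ wasserstein1 ν μ := by
    intro μ ν
    refine le_iInf fun π => le_iInf fun h₁ => le_iInf fun h₂ => ?_
    have h := wasserstein1_map_map_le π (X := Prod.snd) (Y := Prod.fst)
      measurable_snd measurable_fst
    simp only [edist_comm (Prod.snd _)] at h
    rwa [h₁, h₂] at h
  exact le_antisymm (key μ ν) (key ν μ)

theorem isProbabilityMeasure_of_map_fst {α β : Type*} [MeasurableSpace α] [MeasurableSpace β]
    {π : Measure (α × β)} {μ : Measure α} [IsProbabilityMeasure μ] (h : π.map Prod.fst = μ) :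
    IsProbabilityMeasure π := by
  constructor
  rw [← Set.preimage_univ (f := (Prod.fst : α × β → α)),
    ← Measure.map_apply measurable_fst MeasurableSet.univ, h, measure_univ]

/-- Two couplings with a common marginal can be glued. -/
theorem exists_gluing {α β γ : Type*} [MeasurableSpace α] [MeasurableSpace β] [MeasurableSpace γ]
    [StandardBorelSpace α] [StandardBorelSpace γ] [Nonempty α] [Nonempty γ]
    (π₁ : Measure (α × β)) (π₂ : Measure (β × γ)) [IsFiniteMeasure π₁] [IsFiniteMeasure π₂]
    (h : π₁.map Prod.snd = π₂.map Prod.fst) :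
    ∃ ρ : Measure (β × α × γ), ρ.map (fun p => (p.2.1, p.1)) = π₁ ∧
      ρ.map (fun p => (p.1, p.2.2)) = π₂ := by
  have e₁ : (π₁.map Prod.swap).fst = π₂.fst := by
    rw [Measure.fst, Measure.map_map measurable_fst measurable_swap]; exact h
  have d₁ := (π₁.map Prod.swap).disintegrate (π₁.map Prod.swap).condKernel
  have d₂ := π₂.disintegrate π₂.condKernel
  rw [e₁] at d₁
  -- Make the outer coordinates conditionally independent given the common middle one.
  refine ⟨π₂.fst ⊗ₘ ((π₁.map Prod.swap).condKernel ×ₖ π₂.condKernel), ?_, ?_⟩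
  · have : (fun p : β × α × γ => (p.2.1, p.1)) = Prod.swap ∘ Prod.map id Prod.fst := rfl
    rw [this, ← Measure.map_map (by fun_prop) (by fun_prop), ← Measure.compProd_map measurable_fst,
      ← Kernel.fst_eq, Kernel.fst_prod, d₁, Measure.map_map (by fun_prop) (by fun_prop)]
    simp
  · have : (fun p : β × α × γ => (p.1, p.2.2)) = Prod.map id Prod.snd := rfl
    rw [this, ← Measure.compProd_map measurable_snd, ← Kernel.snd_eq, Kernel.snd_prod, d₂]

theorem wasserstein1_triangle (μ ν ρ : Measure (Euc d)) [IsProbabilityMeasure μ]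
    [IsProbabilityMeasure ν] :
    wasserstein1 μ ρ ≤ wasserstein1 μ ν + wasserstein1 ν ρ := by
  refine ENNReal.le_of_forall_pos_le_add fun c hc hfin => ?_
  have hc' : (c / 2 : ℝ≥0∞) ≠ 0 := by simpa using hc.ne'
  obtain ⟨hf₁, hf₂⟩ := ENNReal.add_lt_top.1 hfin
  obtain ⟨π₁, h₁, h₁', h₁c⟩ := exists_coupling_of_wasserstein1_lt
    (ENNReal.lt_add_right hf₁.ne hc')
  obtain ⟨π₂, h₂, h₂', h₂c⟩ := exists_coupling_of_wasserstein1_lt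
    (ENNReal.lt_add_right hf₂.ne hc')
  have := isProbabilityMeasure_of_map_fst h₁
  have := isProbabilityMeasure_of_map_fst h₂
  obtain ⟨Q, hQ₁, hQ₂⟩ := exists_gluing π₁ π₂ (h₁'.trans h₂.symm)
  have e₁ : Q.map (fun p => p.2.1) = μ := by
    rw [← h₁, ← hQ₁, Measure.map_map (by fun_prop) (by fun_prop)]; rfl
  have e₂ : Q.map (fun p => p.2.2) = ρ := by
    rw [← h₂', ← hQ₂, Measure.map_map (by fun_prop) (by fun_prop)]; rfl
  rw [← hQ₁, lintegral_map (by fun_prop) (by fun_prop)] at h₁c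
  rw [← hQ₂, lintegral_map (by fun_prop) (by fun_prop)] at h₂c
  calc wasserstein1 μ ρ
      = wasserstein1 (Q.map fun p => p.2.1) (Q.map fun p => p.2.2) := by rw [e₁, e₂]
    _ ≤ ∫⁻ p, edist p.2.1 p.2.2 ∂Q := wasserstein1_map_map_le Q (by fun_prop) (by fun_prop)
    _ ≤ ∫⁻ p, (edist p.2.1 p.1 + edist p.1 p.2.2) ∂Q :=
        lintegral_mono fun p => edist_triangle _ _ _
    _ = (∫⁻ p, edist p.2.1 p.1 ∂Q) + ∫⁻ p, edist p.1 p.2.2 ∂Q :=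
        lintegral_add_left (by fun_prop) _
    _ ≤ (wasserstein1 μ ν + c / 2) + (wasserstein1 ν ρ + c / 2) := add_le_add h₁c.le h₂c.le
    _ = wasserstein1 μ ν + wasserstein1 ν ρ + (c / 2 + c / 2) := by ring
    _ = _ := by rw [ENNReal.add_halves]

/-- Under a nearly optimal coupling, mass starting in `F` either stays within `r` of `F` or travels
at least `r`; Markov's inequality bounds the latter. -/
theorem measure_le_measure_cthickening_add (μ ν : Measure (Euc d)) (F : Set (Euc d))
    (hF : MeasurableSet F) {r : ℝ} (hr : 0 < r) :
    μ F ≤ ν (Metric.cthickening r F) + wasserstein1 μ ν / ENNReal.ofReal r := by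
  refine ENNReal.le_of_forall_pos_le_add fun c hc hfin => ?_
  have hr' : ENNReal.ofReal r ≠ 0 := by simpa using hr
  have hW : wasserstein1 μ ν ≠ ∞ := by
    rintro h
    rw [h, ENNReal.top_div_of_ne_top ENNReal.ofReal_ne_top, add_top] at hfin
    exact lt_irrefl _ hfin
  obtain ⟨π, h₁, h₂, h₃⟩ := exists_coupling_of_wasserstein1_lt
    (ENNReal.lt_add_right hW (b := c * ENNReal.ofReal r)
      (mul_ne_zero (by exact_mod_cast hc.ne') hr'))
  have hsub : Prod.fst ⁻¹' F ⊆ Prod.snd ⁻¹' (Metric.cthickening r F) ∪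
      {p : Euc d × Euc d | ENNReal.ofReal r ≤ edist p.1 p.2} := by
    intro p hp
    by_cases h : ENNReal.ofReal r ≤ edist p.1 p.2
    · exact Or.inr h
    · refine Or.inl (Metric.mem_cthickening_of_edist_le _ p.1 _ _ hp ?_)
      rw [edist_comm]; exact (not_le.1 h).le
  calc μ F = π (Prod.fst ⁻¹' F) := by rw [← h₁, Measure.map_apply measurable_fst hF]
    _ ≤ π (Prod.snd ⁻¹' (Metric.cthickening r F)) +
        π {p | ENNReal.ofReal r ≤ edist p.1 p.2} :=
        (measure_mono hsub).trans (measure_union_le _ _)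
    _ ≤ ν (Metric.cthickening r F) + (∫⁻ p, edist p.1 p.2 ∂π) / ENNReal.ofReal r := by
        rw [← h₂, Measure.map_apply measurable_snd Metric.isClosed_cthickening.measurableSet]
        gcongr
        exact meas_ge_le_lintegral_div (by fun_prop) hr' ENNReal.ofReal_ne_top
    _ ≤ ν (Metric.cthickening r F) + (wasserstein1 μ ν + c * ENNReal.ofReal r) /
        ENNReal.ofReal r := by gcongr
    _ = _ := by
        rw [ENNReal.add_div, ENNReal.mul_div_cancel_right hr' ENNReal.ofReal_ne_top, add_assoc]

/-- Letting the thickening shrink compares the two measures on closed sets, which form a generating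
π-system. -/
theorem eq_of_wasserstein1_eq_zero {μ ν : Measure (Euc d)} [IsProbabilityMeasure μ]
    [IsProbabilityMeasure ν] (h : wasserstein1 μ ν = 0) : μ = ν := by
  have key : ∀ (μ ν : Measure (Euc d)) [IsProbabilityMeasure μ] [IsProbabilityMeasure ν],
      wasserstein1 μ ν = 0 → ∀ F, IsClosed F → μ F ≤ ν F := by
    intro μ ν _ _ h F hF
    have hlim : Tendsto (fun r => ν (Metric.cthickening r F)) (nhdsWithin 0 (Set.Ioi 0))
        (nhds (ν F)) :=
      (tendsto_measure_cthickening_of_isClosed ⟨1, one_pos, measure_ne_top _ _⟩ hF).mono_left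
        nhdsWithin_le_nhds
    refine ge_of_tendsto hlim ?_
    filter_upwards [self_mem_nhdsWithin] with r hr
    simpa [h] using measure_le_measure_cthickening_add μ ν F hF.measurableSet hr
  refine ext_of_generate_finite _ ?_ isPiSystem_isClosed (fun F hF => ?_) (by simp)
  · rw [BorelSpace.measurable_eq (α := Euc d), borel_eq_generateFrom_isClosed]
  · exact le_antisymm (key μ ν h F hF) (key ν μ (by rwa [wasserstein1_comm]) F hF)

theorem wasserstein1_le_add_moments (μ ν : Measure (Euc d)) [IsProbabilityMeasure μ]
    [IsProbabilityMeasure ν] :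
    wasserstein1 μ ν ≤ (∫⁻ x, ‖x‖ₑ ∂μ) + ∫⁻ x, ‖x‖ₑ ∂ν := by
  have h := wasserstein1_le_lintegral (μ.prod ν)
  have e₁ : (μ.prod ν).map Prod.fst = μ := by simp
  have e₂ : (μ.prod ν).map Prod.snd = ν := by simp
  rw [e₁, e₂] at h
  refine h.trans ?_
  calc ∫⁻ p, edist p.1 p.2 ∂(μ.prod ν) ≤ ∫⁻ p, (‖p.1‖ₑ + ‖p.2‖ₑ) ∂(μ.prod ν) :=
        lintegral_mono fun p => by rw [edist_eq_enorm_sub]; exact enorm_sub_le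
    _ = (∫⁻ p, ‖p.1‖ₑ ∂(μ.prod ν)) + ∫⁻ p, ‖p.2‖ₑ ∂(μ.prod ν) :=
        lintegral_add_left (by fun_prop) _
    _ = (∫⁻ x, ‖x‖ₑ ∂((μ.prod ν).map Prod.fst)) + ∫⁻ x, ‖x‖ₑ ∂((μ.prod ν).map Prod.snd) := by
        rw [lintegral_map (by fun_prop) measurable_fst, lintegral_map (by fun_prop) measurable_snd]
    _ = _ := by rw [e₁, e₂]

theorem wasserstein1_ne_top {μ ν : ProbabilityMeasure (Euc d)} (hμ : HasFirstMoment μ)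
    (hν : HasFirstMoment ν) :
    wasserstein1 (μ : Measure (Euc d)) (ν : Measure (Euc d)) ≠ ∞ :=
  ((wasserstein1_le_add_moments _ _).trans_lt (ENNReal.add_lt_top.2 ⟨hμ, hν⟩)).ne

end Wasserstein

/-! ### Empirical measures. -/

section Empirical

variable {d : ℕ}

theorem coe_empirical (N : ℕ+) (x : Fin N → Euc d) :
    (empirical N x : Measure (Euc d)) = ((N : ℕ) : ℝ≥0∞)⁻¹ • ∑ i, Measure.dirac (x i) := rfl

theorem lintegral_empirical (N : ℕ+) (x : Fin N → Euc d) (g : Euc d → ℝ≥0∞) :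
    ∫⁻ y, g y ∂(empirical N x : Measure (Euc d)) = ((N : ℕ) : ℝ≥0∞)⁻¹ * ∑ i, g (x i) := by
  simp [coe_empirical, lintegral_smul_measure]

theorem inv_card_ne_top (N : ℕ+) : (((N : ℕ) : ℝ≥0∞)⁻¹) ≠ ∞ :=
  ENNReal.inv_ne_top.2 (by exact_mod_cast N.ne_zero)

theorem hasFirstMoment_empirical (N : ℕ+) (x : Fin N → Euc d) :
    HasFirstMoment (empirical N x) := by
  rw [HasFirstMoment, lintegral_empirical]
  refine ENNReal.mul_lt_top (inv_card_ne_top N).lt_top ?_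
  exact ENNReal.sum_lt_top.2 fun i _ => enorm_lt_top

theorem wasserstein1_empirical_le (N : ℕ+) (x y : Fin N → Euc d) :
    wasserstein1 (empirical N x : Measure (Euc d)) (empirical N y : Measure (Euc d)) ≤
      ((N : ℕ) : ℝ≥0∞)⁻¹ * ∑ i, edist (x i) (y i) := by
  have h := wasserstein1_le_lintegral
    (((N : ℕ) : ℝ≥0∞)⁻¹ • ∑ i, Measure.dirac (x i, y i))
  have e : ∀ g : Euc d × Euc d → Euc d, Measurable g →
      (((N : ℕ) : ℝ≥0∞)⁻¹ • ∑ i, Measure.dirac (x i, y i)).map g =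
        ((N : ℕ) : ℝ≥0∞)⁻¹ • ∑ i, Measure.dirac (g (x i, y i)) := by
    intro g hg
    rw [Measure.map_smul, Measure.map_finset_sum hg.aemeasurable]
    simp [Measure.map_dirac' hg]
  rw [e _ measurable_fst, e _ measurable_snd] at h
  rw [coe_empirical, coe_empirical]
  refine h.trans (le_of_eq ?_)
  simp [lintegral_smul_measure]

theorem measurable_empirical (N : ℕ+) :
    Measurable (empirical N : (Fin N → Euc d) → ProbabilityMeasure (Euc d)) := by
  refine Measurable.subtype_mk (Measure.measurable_of_measurable_coe _ fun s hs => ?_)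
  simp only [empiricalAux, Measure.smul_apply, Measure.finsetSum_apply, smul_eq_mul,
    Measure.dirac_apply' _ hs]
  refine Measurable.const_mul (Finset.measurable_sum _ fun i _ => ?_) _
  exact (measurable_one.indicator hs).comp (measurable_pi_apply i)

theorem inv_card_mul_sum_const (N : ℕ+) (c : ℝ≥0∞) :
    ((N : ℕ) : ℝ≥0∞)⁻¹ * ∑ _i : Fin N, c = c := by
  have h : ((N : ℕ) : ℝ≥0∞) ≠ 0 := by exact_mod_cast N.ne_zero
  rw [Finset.sum_const, Finset.card_univ, Fintype.card_fin, nsmul_eq_mul, ← mul_assoc,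
    ENNReal.inv_mul_cancel h (ENNReal.natCast_ne_top _), one_mul]

theorem inv_card_mul_sum_le {N : ℕ+} {g : Fin N → ℝ≥0∞} {c : ℝ≥0∞} (h : ∀ i, g i ≤ c) :
    ((N : ℕ) : ℝ≥0∞)⁻¹ * ∑ i, g i ≤ c := by
  calc _ ≤ ((N : ℕ) : ℝ≥0∞)⁻¹ * ∑ _i : Fin N, c := by gcongr; exact h _
    _ = c := inv_card_mul_sum_const N c

theorem wasserstein1_empirical_left_le (N : ℕ+) (x y : Fin N → Euc d)
    (ν : ProbabilityMeasure (Euc d)) :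
    wasserstein1 (empirical N x : Measure (Euc d)) (ν : Measure (Euc d)) ≤
      ((N : ℕ) : ℝ≥0∞)⁻¹ * ∑ i, edist (x i) (y i) +
        wasserstein1 (empirical N y : Measure (Euc d)) (ν : Measure (Euc d)) :=
  (wasserstein1_triangle _ (empirical N y : Measure (Euc d)) _).trans
    (add_le_add_left (wasserstein1_empirical_le N x y) _)

/-- Moving the points changes the distance by at most their average displacement, so the map is
1-Lipschitz for the sup metric, hence continuous. -/
theorem measurable_wasserstein1_empirical (N : ℕ+) (ν : ProbabilityMeasure (Euc d)) :
    Measurable fun x : Fin N → Euc d =>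
      wasserstein1 (empirical N x : Measure (Euc d)) (ν : Measure (Euc d)) := by
  refine (continuous_of_le_add_edist 1 ENNReal.one_ne_top fun x y => ?_).measurable
  rw [one_mul, add_comm]
  refine (wasserstein1_empirical_left_le N x y ν).trans ?_
  gcongr
  exact inv_card_mul_sum_le fun i => edist_le_pi_edist x y i

end Empirical

/-! ### Wasserstein distance between measures on a finite set. -/

section FiniteSupport

variable {d : ℕ}

theorem eq_sum_smul_dirac_of_measure_compl_eq_zero {α : Type*} [MeasurableSpace α]
    [MeasurableSingletonClass α] (μ : Measure α) (S : Finset α) (h : μ (S : Set α)ᶜ = 0) :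
    μ = ∑ k ∈ S, μ {k} • Measure.dirac k := by
  have e : (S : Set α) = ⋃ k ∈ S, {k} := by ext; simp
  have hr : μ.restrict (S : Set α) = μ := Measure.restrict_eq_self_of_ae_mem (mem_ae_iff.2 h)
  conv_lhs => rw [← hr, e, Measure.restrict_biUnion_finset
    (fun i _ j _ hij => Set.disjoint_singleton.2 hij) (fun i => measurableSet_singleton i)]
  simp_rw [Measure.restrict_singleton]
  exact Measure.sum_coe_finset S (fun k => μ {k} • Measure.dirac k)

/-- On a finite set the Wasserstein distance is bounded by the total variation distance. -/
theorem wasserstein1_sum_smul_dirac_le (S : Finset (Euc d)) (p q : Euc d → ℝ≥0∞)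
    (hp : ∑ k ∈ S, p k = 1) (hq : ∑ k ∈ S, q k = 1) {M : ℝ≥0∞}
    (hM : ∀ k ∈ S, ∀ l ∈ S, edist k l ≤ M) :
    wasserstein1 (∑ k ∈ S, p k • Measure.dirac k) (∑ k ∈ S, q k • Measure.dirac k) ≤
      M * ∑ k ∈ S, (p k - q k) := by
  set t := ∑ k ∈ S, (p k - q k) with ht
  have hmin : ∀ a b : ℝ≥0∞, min a b + (a - b) = a := by
    intro a b
    rcases le_total a b with h | h
    · rw [min_eq_left h, tsub_eq_zero_of_le h, add_zero]
    · rw [min_eq_right h, add_tsub_cancel_of_le h]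
  have hmin_ne : ∑ k ∈ S, min (p k) (q k) ≠ ∞ := by
    refine ne_top_of_le_ne_top ENNReal.one_ne_top ?_
    rw [← hp]; exact Finset.sum_le_sum fun _ _ => min_le_left _ _
  -- Subtraction is truncated, so these are the two excess masses; they agree because both measures
  -- have mass 1.
  have ht' : ∑ k ∈ S, (q k - p k) = t := by
    have h₁ : ∑ k ∈ S, min (p k) (q k) + t = 1 := by
      rw [ht, ← Finset.sum_add_distrib, ← hp]; simp_rw [hmin]
    have h₂ : ∑ k ∈ S, min (p k) (q k) + ∑ k ∈ S, (q k - p k) = 1 := by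
      rw [← Finset.sum_add_distrib, ← hq]; simp_rw [min_comm (p _), hmin]
    exact (ENNReal.add_right_inj hmin_ne).1 (h₂.trans h₁.symm)
  have ht_top : t ≠ ∞ := by
    refine ne_top_of_le_ne_top ENNReal.one_ne_top ?_
    rw [← hp]; exact Finset.sum_le_sum fun _ _ => tsub_le_self
  have hcancel : ∀ a, a ≤ t → t⁻¹ * (a * t) = a := by
    intro a ha
    rcases eq_or_ne t 0 with h0 | h0
    · rw [h0] at ha ⊢; simp [nonpos_iff_eq_zero.1 ha]
    · rw [mul_comm a, ← mul_assoc, ENNReal.inv_mul_cancel h0 ht_top, one_mul]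
  have hle₁ : ∀ k ∈ S, p k - q k ≤ t := fun k hk =>
    Finset.single_le_sum (f := fun k => p k - q k) (fun _ _ => zero_le) hk
  have hle₂ : ∀ k ∈ S, q k - p k ≤ t := fun k hk => by
    rw [← ht']
    exact Finset.single_le_sum (f := fun k => q k - p k) (fun _ _ => zero_le) hk
  -- The common mass stays in place, and the excess of `p` is sent to the excess of `q` by a
  -- normalised product. For `t = 0` the second term vanishes, as `∞ * 0 = 0`.
  set π : Measure (Euc d × Euc d) := ∑ k ∈ S, min (p k) (q k) • Measure.dirac (k, k) +
    t⁻¹ • ∑ k ∈ S, ∑ l ∈ S, ((p k - q k) * (q l - p l)) • Measure.dirac (k, l) with hπ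
  have hmap : ∀ g : Euc d × Euc d → Euc d, Measurable g →
      π.map g = ∑ k ∈ S, min (p k) (q k) • Measure.dirac (g (k, k)) +
        t⁻¹ • ∑ k ∈ S, ∑ l ∈ S, ((p k - q k) * (q l - p l)) • Measure.dirac (g (k, l)) := by
    intro g hg
    simp only [hπ, Measure.map_add _ _ hg, Measure.map_smul,
      Measure.map_finset_sum hg.aemeasurable, Measure.map_dirac' hg]
  have e₁ : π.map Prod.fst = ∑ k ∈ S, p k • Measure.dirac k := by
    rw [hmap _ measurable_fst]
    simp_rw [← Finset.sum_smul, ← Finset.mul_sum, ht', Finset.smul_sum, smul_smul,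
      ← Finset.sum_add_distrib, ← add_smul]
    refine Finset.sum_congr rfl fun k hk => ?_
    rw [hcancel _ (hle₁ k hk), hmin]
  have e₂ : π.map Prod.snd = ∑ k ∈ S, q k • Measure.dirac k := by
    rw [hmap _ measurable_snd, Finset.sum_comm (γ := Euc d)]
    simp_rw [← Finset.sum_smul, ← Finset.sum_mul, ← ht, Finset.smul_sum, smul_smul,
      ← Finset.sum_add_distrib, ← add_smul]
    refine Finset.sum_congr rfl fun k hk => ?_
    rw [mul_comm t, hcancel _ (hle₂ k hk), min_comm, hmin]
  have h := wasserstein1_le_lintegral π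
  rw [e₁, e₂] at h
  refine h.trans ?_
  simp only [hπ, lintegral_add_measure, lintegral_smul_measure, lintegral_finsetSum_measure,
    lintegral_dirac, edist_self, mul_zero, Finset.sum_const_zero, zero_add,
    smul_eq_mul]
  calc t⁻¹ * ∑ k ∈ S, ∑ l ∈ S, (p k - q k) * (q l - p l) * edist k l
      ≤ t⁻¹ * ∑ k ∈ S, ∑ l ∈ S, (p k - q k) * (q l - p l) * M := by
        gcongr with k hk l hl; exact hM k hk l hl
    _ = t⁻¹ * (t * t) * M := by
        simp_rw [← Finset.sum_mul, ← Finset.mul_sum, ht', ← Finset.sum_mul, ← ht, mul_assoc]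
    _ = M * t := by rw [hcancel t le_rfl, mul_comm]

theorem wasserstein1_le_of_finite_support {μ ν : Measure (Euc d)} [IsProbabilityMeasure μ]
    [IsProbabilityMeasure ν] (S : Finset (Euc d)) (hμ : μ (S : Set (Euc d))ᶜ = 0)
    (hν : ν (S : Set (Euc d))ᶜ = 0) {M : ℝ≥0∞} (hM : ∀ k ∈ S, ∀ l ∈ S, edist k l ≤ M) :
    wasserstein1 μ ν ≤ M * ∑ k ∈ S, (μ {k} - ν {k}) := by
  have hsum : ∀ (ρ : Measure (Euc d)) [IsProbabilityMeasure ρ], ρ (S : Set (Euc d))ᶜ = 0 →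
      ∑ k ∈ S, ρ {k} = 1 := by
    intro ρ _ hρ
    rw [sum_measure_singleton]
    exact (prob_compl_eq_zero_iff S.measurableSet).1 hρ
  have h := wasserstein1_sum_smul_dirac_le S (fun k => μ {k}) (fun k => ν {k}) (hsum μ hμ)
    (hsum ν hν) hM
  rwa [← eq_sum_smul_dirac_of_measure_compl_eq_zero μ S hμ,
    ← eq_sum_smul_dirac_of_measure_compl_eq_zero ν S hν] at h

end FiniteSupport

/-! ### Law of large numbers in mean Wasserstein distance. -/

section LawOfLargeNumbers

variable {d : ℕ}

/-- The positive part is at most the absolute deviation from the mean, and the `L¹` norm is at most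
the `L²` norm, the square root of a variance of order `1/N`. -/
theorem lintegral_empirical_apply_sub_le (N : ℕ+) (ν : Measure (Euc d)) [IsProbabilityMeasure ν]
    {B : Set (Euc d)} (hB : MeasurableSet B) :
    ∫⁻ y, ((empirical N y : Measure (Euc d)) B - ν B) ∂(Measure.pi fun _ : Fin N => ν) ≤
      (((N : ℕ) : ℝ≥0∞)⁻¹) ^ (1 / 2 : ℝ) := by
  have hN : (0 : ℝ) < (N : ℕ) := by exact_mod_cast N.pos
  set Q := Measure.pi fun _ : Fin N => ν with hQ
  set g : Euc d → ℝ := fun x => ((N : ℕ) : ℝ)⁻¹ * B.indicator 1 x with hg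
  have hgm : Measurable g := (measurable_one.indicator hB).const_mul _
  have hg01 : ∀ x, g x ∈ Set.Icc 0 ((N : ℕ) : ℝ)⁻¹ := by
    intro x
    by_cases hx : x ∈ B <;> simp [hg, hx]
  have hgL : MemLp g 2 ν := by
    refine MemLp.of_bound hgm.aestronglyMeasurable ((N : ℕ) : ℝ)⁻¹ (ae_of_all _ fun x => ?_)
    rw [Real.norm_of_nonneg (hg01 x).1]; exact (hg01 x).2
  set h : (Fin N → Euc d) → ℝ := ∑ i, fun y : Fin N → Euc d => g (y i) with hh
  have hL : MemLp h 2 Q := memLp_finsetSum' _ fun i _ =>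
    hgL.comp_measurePreserving (measurePreserving_eval (fun _ : Fin N => ν) i)
  have hvar : Var[h; Q] ≤ ((N : ℕ) : ℝ)⁻¹ := by
    rw [hh, hQ, variance_sum_pi fun _ => hgL]
    have : ∀ i : Fin N, Var[g; ν] ≤ ((N : ℕ) : ℝ)⁻¹ ^ 2 := fun _ =>
      (variance_le_sq_of_bounded (ae_of_all _ hg01) hgm.aemeasurable).trans (by
        rw [sub_zero, div_pow]; exact div_le_self (by positivity) (by norm_num))
    refine (Finset.sum_le_sum fun i _ => this i).trans (le_of_eq ?_)
    simp only [Finset.sum_const, Finset.card_univ, Fintype.card_fin, nsmul_eq_mul]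
    field_simp
  have hint : ∫ x, g x ∂ν = ((N : ℕ) : ℝ)⁻¹ * ν.real B := by
    simp only [hg, integral_const_mul, integral_indicator_one hB]
  have hmean : ∫ y, h y ∂Q = ν.real B := by
    simp only [hh, Finset.sum_apply]
    have hi : ∀ i : Fin N, Integrable (fun y : Fin N → Euc d => g (y i)) Q := fun i =>
      (hgL.comp_measurePreserving
        (measurePreserving_eval (fun _ : Fin N => ν) i)).integrable (by norm_num)
    rw [integral_finsetSum _ fun i _ => hi i]
    have : ∀ i : Fin N, ∫ y, g (y i) ∂Q = ((N : ℕ) : ℝ)⁻¹ * ν.real B := fun i => by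
      rw [← hint]; exact integral_comp_eval (i := i) hgm.aestronglyMeasurable
    simp only [this, Finset.sum_const, Finset.card_univ, Fintype.card_fin, nsmul_eq_mul]
    field_simp
  have hpt : ∀ y, (empirical N y : Measure (Euc d)) B - ν B ≤ ‖h y - ∫ y, h y ∂Q‖ₑ := by
    intro y
    have e : (empirical N y : Measure (Euc d)) B = ENNReal.ofReal (h y) := by
      rw [← lintegral_indicator_one hB, lintegral_empirical, hh, Finset.sum_apply,
        ENNReal.ofReal_sum_of_nonneg fun i _ => (hg01 (y i)).1, Finset.mul_sum]
      refine Finset.sum_congr rfl fun i _ => ?_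
      by_cases hx : y i ∈ B
      · simp [hg, hx, ENNReal.ofReal_inv_of_pos hN]
      · simp [hg, hx]
    rw [hmean, e, ← ofReal_measureReal, ← ENNReal.ofReal_sub _ measureReal_nonneg]
    exact Real.ofReal_le_enorm _
  calc ∫⁻ y, ((empirical N y : Measure (Euc d)) B - ν B) ∂Q
      ≤ ∫⁻ y, ‖h y - ∫ y, h y ∂Q‖ₑ ∂Q := lintegral_mono hpt
    _ = eLpNorm (fun y => h y - ∫ y, h y ∂Q) 1 Q := eLpNorm_one_eq_lintegral_enorm.symm
    _ ≤ eLpNorm (fun y => h y - ∫ y, h y ∂Q) 2 Q :=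
        eLpNorm_le_eLpNorm_of_exponent_le (by norm_num)
          (hL.aestronglyMeasurable.sub aestronglyMeasurable_const)
    _ = (eVar[h; Q]) ^ (1 / 2 : ℝ) := by
        rw [eLpNorm_eq_lintegral_rpow_enorm_toReal two_ne_zero ENNReal.ofNat_ne_top, evariance]
        simp
    _ ≤ _ := by
        rw [← ofReal_variance hL]
        gcongr
        rw [← ENNReal.ofReal_natCast, ← ENNReal.ofReal_inv_of_pos hN]
        exact ENNReal.ofReal_le_ofReal hvar

theorem map_empirical (N : ℕ+) (y : Fin N → Euc d) {g : Euc d → Euc d} (hg : Measurable g) :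
    (empirical N y : Measure (Euc d)).map g = (empirical N fun i => g (y i) : Measure (Euc d)) := by
  simp only [coe_empirical, Measure.map_smul, Measure.map_finset_sum hg.aemeasurable,
    Measure.map_dirac' hg]

theorem lintegral_pi_average (N : ℕ+) (ν : Measure (Euc d)) [IsProbabilityMeasure ν]
    {g : Euc d → ℝ≥0∞} (hg : Measurable g) :
    ∫⁻ y, ((N : ℕ) : ℝ≥0∞)⁻¹ * ∑ i, g (y i) ∂(Measure.pi fun _ : Fin N => ν) =
      ∫⁻ x, g x ∂ν := by
  rw [lintegral_const_mul' _ _ (inv_card_ne_top N), lintegral_finsetSum _ (by fun_prop)]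
  have : ∀ i : Fin N, ∫⁻ y, g (y i) ∂(Measure.pi fun _ : Fin N => ν) = ∫⁻ x, g x ∂ν := fun i =>
    (measurePreserving_eval (fun _ : Fin N => ν) i).lintegral_comp hg
  simp_rw [this]
  exact inv_card_mul_sum_const N _

/-- Discretise by `s`: pass from the sample to its image, then to the image of `ν`, then to `ν`. The
outer legs have the same mean cost; the middle one lives on a finite set and is handled atom by
atom. -/
theorem lintegral_wasserstein1_empirical_le (N : ℕ+) (ν : ProbabilityMeasure (Euc d))
    (s : SimpleFunc (Euc d) (Euc d)) {M : ℝ≥0∞} (hM : ∀ k ∈ s.range, ∀ l ∈ s.range, edist k l ≤ M) :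
    ∫⁻ y, wasserstein1 (empirical N y : Measure (Euc d)) (ν : Measure (Euc d))
        ∂(Measure.pi fun _ : Fin N => (ν : Measure (Euc d))) ≤
      2 * ∫⁻ x, edist x (s x) ∂(ν : Measure (Euc d)) +
        M * (s.range.card * (((N : ℕ) : ℝ≥0∞)⁻¹) ^ (1 / 2 : ℝ)) := by
  set ν' : Measure (Euc d) := (ν : Measure (Euc d)) with hν'
  have hs : Measurable s := s.measurable
  set c := ∫⁻ x, edist x (s x) ∂ν' with hc
  have : IsProbabilityMeasure (ν'.map s) := Measure.isProbabilityMeasure_map hs.aemeasurable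
  have hsupp : ∀ ρ : Measure (Euc d), ρ.map s (s.range : Set (Euc d))ᶜ = 0 := by
    intro ρ
    rw [Measure.map_apply hs s.range.measurableSet.compl]
    convert measure_empty (μ := ρ)
    ext x; simp
  have hpt : ∀ y : Fin N → Euc d, wasserstein1 (empirical N y : Measure (Euc d)) ν' ≤
      ((N : ℕ) : ℝ≥0∞)⁻¹ * ∑ i, edist (y i) (s (y i)) +
        (M * ∑ k ∈ s.range, ((empirical N y : Measure (Euc d)) (s ⁻¹' {k}) - ν' (s ⁻¹' {k})) + c) := by
    intro y
    refine (wasserstein1_empirical_left_le N y (fun i => s (y i)) ν).trans ?_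
    gcongr
    refine (wasserstein1_triangle _ (ν'.map s) _).trans ?_
    gcongr
    · rw [← map_empirical N y hs]
      have : IsProbabilityMeasure ((empirical N y : Measure (Euc d)).map s) :=
        Measure.isProbabilityMeasure_map hs.aemeasurable
      refine (wasserstein1_le_of_finite_support s.range (hsupp _) (hsupp _) hM).trans (le_of_eq ?_)
      simp only [Measure.map_apply hs (measurableSet_singleton _)]
    · have h := wasserstein1_map_map_le ν' hs measurable_id
      simp only [Measure.map_id] at h
      refine h.trans (le_of_eq ?_)
      simp [hc, edist_comm]
  have hmeas : ∀ k ∈ s.range, Measurable fun y : Fin N → Euc d =>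
      (empirical N y : Measure (Euc d)) (s ⁻¹' {k}) - ν' (s ⁻¹' {k}) := fun k _ =>
    ((Measure.measurable_coe (hs (measurableSet_singleton k))).comp
      (measurable_subtype_coe.comp (measurable_empirical N))).sub_const _
  refine (lintegral_mono hpt).trans ?_
  rw [lintegral_add_left (by fun_prop),
    lintegral_pi_average N ν' (g := fun x => edist x (s x)) (by fun_prop),
    lintegral_add_right _ measurable_const, lintegral_const_mul _ (Finset.measurable_sum _ hmeas),
    lintegral_finsetSum _ hmeas, lintegral_const, measure_univ, mul_one, ← hc, two_mul]
  calc _ ≤ c + (M * ∑ k ∈ s.range, (((N : ℕ) : ℝ≥0∞)⁻¹) ^ (1 / 2 : ℝ) + c) := by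
        gcongr with k hk
        exact lintegral_empirical_apply_sub_le N ν' (hs (measurableSet_singleton k))
    _ = _ := by rw [Finset.sum_const, nsmul_eq_mul]; ring

/-- The empirical measure of an i.i.d. sample converges in mean Wasserstein distance. -/
theorem tendsto_lintegral_wasserstein1_empirical (ν : ProbabilityMeasure (Euc d))
    (hν : HasFirstMoment ν) :
    Tendsto (fun N : ℕ+ => ∫⁻ y, wasserstein1 (empirical N y : Measure (Euc d))
      (ν : Measure (Euc d)) ∂(Measure.pi fun _ : Fin N => (ν : Measure (Euc d)))) atTop (nhds 0) := by
  rw [ENNReal.tendsto_nhds_zero]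
  intro c hc
  have hid : MemLp (id : Euc d → Euc d) 1 (ν : Measure (Euc d)) := by
    refine ⟨measurable_id.aestronglyMeasurable, ?_⟩
    rw [eLpNorm_one_eq_lintegral_enorm]; exact hν
  obtain ⟨s, hs, -⟩ := hid.exists_simpleFunc_eLpNorm_sub_lt ENNReal.one_ne_top
    -- A quarter of `c`, since the discretisation error is paid twice.
    (ε := c / 2 / 2) (by simpa using hc.ne')
  rw [eLpNorm_one_eq_lintegral_enorm] at hs
  have hs' : 2 * ∫⁻ x, edist x (s x) ∂(ν : Measure (Euc d)) ≤ c / 2 := by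
    simp only [edist_eq_enorm_sub]
    calc _ ≤ 2 * (c / 2 / 2) := by gcongr; exact hs.le
      _ = c / 2 := ENNReal.mul_div_cancel two_ne_zero ENNReal.ofNat_ne_top
  obtain ⟨M, hM_top, hM⟩ : ∃ M : ℝ≥0∞, M ≠ ∞ ∧ ∀ k ∈ s.range, ∀ l ∈ s.range, edist k l ≤ M :=
    ⟨Metric.ediam (s.range : Set (Euc d)), s.range.finite_toSet.isBounded.ediam_ne_top,
      fun k hk l hl => Metric.edist_le_ediam_of_mem hk hl⟩
  have hlim : Tendsto (fun N : ℕ+ => M * (s.range.card * (((N : ℕ) : ℝ≥0∞)⁻¹) ^ (1 / 2 : ℝ)))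
      atTop (nhds 0) := by
    have h₁ : Tendsto (fun N : ℕ+ => ((N : ℕ) : ℝ≥0∞)⁻¹) atTop (nhds 0) :=
      ENNReal.tendsto_inv_nat_nhds_zero.comp tendsto_PNat_val_atTop_atTop
    have h₂ := h₁.ennrpow_const (1 / 2)
    rw [ENNReal.zero_rpow_of_pos (by norm_num)] at h₂
    have h₃ := ENNReal.Tendsto.const_mul (a := M) (ENNReal.Tendsto.const_mul
      (a := (s.range.card : ℝ≥0∞)) h₂ (Or.inr (ENNReal.natCast_ne_top _))) (Or.inr hM_top)
    simpa using h₃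
  filter_upwards [(ENNReal.tendsto_nhds_zero.1 hlim) (c / 2) (ENNReal.half_pos hc.ne')] with N hN
  calc _ ≤ _ := lintegral_wasserstein1_empirical_le N ν s hM
    _ ≤ c / 2 + c / 2 := add_le_add hs' hN
    _ = c := ENNReal.add_halves c

end LawOfLargeNumbers

/-! ### Splitting an i.i.d. sequence into its first term and the rest. -/

section HeadTail

variable {α : Type*} [MeasurableSpace α]

theorem infinitePi_map_head_tail (θ : Measure α) [IsProbabilityMeasure θ] :
    (Measure.infinitePi fun _ : ℕ => θ).map (fun e => (e 0, fun n => e (n + 1))) =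
      θ.prod (Measure.infinitePi fun _ : ℕ => θ) := by
  set cons : α × (ℕ → α) → ℕ → α := fun p n => Nat.casesOn n p.1 p.2 with hcons
  have hcm : Measurable cons := by
    refine measurable_pi_lambda _ fun n => ?_
    cases n with
    | zero => exact measurable_fst
    | succ n => exact (measurable_pi_apply n).comp measurable_snd
  -- The inverse map is treated instead, because its image measure lives on sequences and is
  -- determined by finite-dimensional boxes.
  have key : (θ.prod (Measure.infinitePi fun _ : ℕ => θ)).map cons =
      Measure.infinitePi fun _ : ℕ => θ := by
    refine Measure.eq_infinitePi _ fun s t ht => ?_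
    classical
    set n := s.sup id
    have hsn : s ⊆ Finset.range (n + 1) := fun i hi =>
      Finset.mem_range.2 (Nat.lt_succ_of_le (Finset.le_sup (f := id) hi))
    -- Padding with the whole space replaces `s` by an initial segment of `ℕ`, from which the index
    -- 0 can be split off.
    set u : ℕ → Set α := fun i => if i ∈ s then t i else Set.univ with hu
    have hum : ∀ i, MeasurableSet (u i) := by
      intro i; by_cases h : i ∈ s <;> simp [hu, h, ht]
    have hpre : cons ⁻¹' Set.pi s t =
        u 0 ×ˢ Set.pi (Finset.range n : Set ℕ) (fun i => u (i + 1)) := by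
      ext p
      simp only [Set.mem_preimage, Set.mem_pi, Set.mem_prod, Finset.mem_coe]
      constructor
      · intro h
        refine ⟨?_, fun i _ => ?_⟩
        · by_cases h0 : 0 ∈ s
          · simp only [hu, h0, if_true]; exact h 0 h0
          · simp [hu, h0]
        · by_cases hi : i + 1 ∈ s
          · simpa [hu, hi] using h (i + 1) hi
          · simp [hu, hi]
      · rintro ⟨h₀, h₁⟩ i hi
        cases i with
        | zero => simp only [hu, hi, if_true] at h₀; exact h₀
        | succ i =>
          have := h₁ i (Finset.mem_range.2 (Nat.succ_lt_succ_iff.1 (Finset.mem_range.1 (hsn hi))))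
          simpa [hu, hi] using this
    have hprod : ∏ i ∈ s, θ (t i) = ∏ i ∈ Finset.range (n + 1), θ (u i) := by
      rw [← Finset.prod_subset hsn fun i _ hi => by simp [hu, hi]]
      exact Finset.prod_congr rfl fun i hi => by simp [hu, hi]
    rw [Measure.map_apply hcm (MeasurableSet.pi s.countable_toSet fun i _ => ht i), hpre,
      Measure.prod_prod, Measure.infinitePi_pi _ fun i _ => hum (i + 1), hprod,
      Finset.prod_range_succ', mul_comm]
  conv_lhs => rw [← key]
  rw [Measure.map_map (by fun_prop) hcm]
  exact Measure.map_id

theorem lintegral_infinitePi_head_tail (θ : Measure α) [IsProbabilityMeasure θ]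
    {g : α → (ℕ → α) → ℝ≥0∞} (hg : Measurable fun p : α × (ℕ → α) => g p.1 p.2) :
    ∫⁻ e, g (e 0) (fun n => e (n + 1)) ∂(Measure.infinitePi fun _ : ℕ => θ) =
      ∫⁻ e, ∫⁻ z, g z e ∂θ ∂(Measure.infinitePi fun _ : ℕ => θ) := by
  rw [← lintegral_prod_symm' _ hg, ← infinitePi_map_head_tail, lintegral_map hg (by fun_prop)]

end HeadTail

/-! ### The mean Lipschitz bound for `f`. -/

section Lipschitz

variable {d m : ℕ} {f : Euc d → ProbabilityMeasure (Euc d) → Euc m → Euc d}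

theorem le_mul_of_forall_pos_le {a s b K : ℝ≥0∞} (hs : s ≠ ∞) (hK : K ≠ ∞)
    (h : ∀ c : NNReal, 0 < c → a ≤ s * (b + c * K)) : a ≤ s * b := by
  have hlim : Tendsto (fun c : NNReal => s * (b + (c : ℝ≥0∞) * K)) (nhdsWithin 0 (Set.Ioi 0))
      (nhds (s * (b + ((0 : NNReal) : ℝ≥0∞) * K))) := by
    refine Tendsto.mono_left ?_ nhdsWithin_le_nhds
    refine ENNReal.Tendsto.const_mul (tendsto_const_nhds.add ?_) (Or.inr hs)
    exact ENNReal.Tendsto.mul_const (ENNReal.tendsto_coe.2 tendsto_id) (Or.inr hK)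
  simp only [ENNReal.coe_zero, zero_mul, add_zero] at hlim
  refine ge_of_tendsto hlim ?_
  filter_upwards [self_mem_nhdsWithin] with c hc using h c hc

theorem enorm_sub_le_lipBound_mul {x₁ x₂ : Euc d} {μ₁ μ₂ : ProbabilityMeasure (Euc d)}
    (hx : x₁ ≠ x₂) (hμ : μ₁ ≠ μ₂) (h₁ : HasFirstMoment μ₁) (h₂ : HasFirstMoment μ₂) (z : Euc m) :
    ‖f x₁ μ₁ z - f x₂ μ₂ z‖ₑ ≤ lipBound f z *
      (edist x₁ x₂ + wasserstein1 (μ₁ : Measure (Euc d)) (μ₂ : Measure (Euc d))) := by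
  rw [← ENNReal.div_le_iff (by simp [hx])
    (ENNReal.add_ne_top.2 ⟨edist_ne_top _ _, wasserstein1_ne_top h₁ h₂⟩)]
  unfold lipBound
  refine le_iSup_of_le x₁ <| le_iSup_of_le x₂ <| le_iSup_of_le μ₁ <| le_iSup_of_le μ₂ <|
    le_iSup_of_le hx <| le_iSup_of_le hμ <| le_iSup_of_le h₁ <| le_iSup_of_le h₂ le_rfl

/-- A measure with finite first moment has arbitrarily close neighbours: its translates. -/
theorem exists_translate {μ : ProbabilityMeasure (Euc d)} (hμ : HasFirstMoment μ) {v : Euc d}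
    (hv : v ≠ 0) :
    ∃ μ' : ProbabilityMeasure (Euc d), μ' ≠ μ ∧ HasFirstMoment μ' ∧
      wasserstein1 (μ : Measure (Euc d)) (μ' : Measure (Euc d)) ≤ ‖v‖ₑ := by
  have hm : Measurable fun x : Euc d => x + v := by fun_prop
  have hint : Integrable (fun x : Euc d => x) (μ : Measure (Euc d)) :=
    ⟨measurable_id.aestronglyMeasurable, hμ⟩
  refine ⟨μ.map hm.aemeasurable, ?_, ?_, ?_⟩
  · intro h
    have h' : (μ : Measure (Euc d)).map (fun x => x + v) = μ := congrArg Subtype.val h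
    have e : ∫ x, x ∂((μ : Measure (Euc d)).map fun x => x + v) =
        (∫ x, x ∂(μ : Measure (Euc d))) + v := by
      rw [integral_map (f := fun x => x) hm.aemeasurable measurable_id.aestronglyMeasurable,
        integral_add hint (integrable_const v)]
      simp
    rw [h'] at e
    exact hv (by simpa using e)
  · change ∫⁻ x, ‖x‖ₑ ∂((μ : Measure (Euc d)).map fun x => x + v) < ∞
    rw [lintegral_map (by fun_prop) hm]
    exact (hint.add (integrable_const v)).2
  · have h := wasserstein1_map_map_le (μ : Measure (Euc d)) measurable_id hm
    rw [Measure.map_id] at h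
    refine h.trans (le_of_eq ?_)
    simp [edist_eq_enorm_sub]

variable {θ : ProbabilityMeasure (Euc m)}

theorem measurable_apply_noise
    (hf : Measurable fun p : Euc d × ProbabilityMeasure (Euc d) × Euc m => f p.1 p.2.1 p.2.2)
    (x : Euc d) (μ : ProbabilityMeasure (Euc d)) : Measurable (f x μ) :=
  hf.comp (measurable_const.prodMk (measurable_const.prodMk measurable_id))

theorem lintegral_enorm_sub_triangle
    (hf : Measurable fun p : Euc d × ProbabilityMeasure (Euc d) × Euc m => f p.1 p.2.1 p.2.2)
    (x₁ x₂ x₃ : Euc d) (μ₁ μ₂ μ₃ : ProbabilityMeasure (Euc d)) :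
    ∫⁻ z, ‖f x₁ μ₁ z - f x₃ μ₃ z‖ₑ ∂(θ : Measure (Euc m)) ≤
      ∫⁻ z, ‖f x₁ μ₁ z - f x₂ μ₂ z‖ₑ ∂(θ : Measure (Euc m)) +
        ∫⁻ z, ‖f x₂ μ₂ z - f x₃ μ₃ z‖ₑ ∂(θ : Measure (Euc m)) := by
  have h₁ := measurable_apply_noise hf x₁ μ₁
  have h₂ := measurable_apply_noise hf x₂ μ₂
  rw [← lintegral_add_left (by fun_prop)]
  refine lintegral_mono fun z => ?_
  simp only [← edist_eq_enorm_sub]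
  exact edist_triangle _ _ _

/-- No measurability of `lipBound f` is available; the factor leaves the integral because it is
finite. -/
theorem lintegral_enorm_sub_le_of_ne {x₁ x₂ : Euc d} {μ₁ μ₂ : ProbabilityMeasure (Euc d)}
    (hx : x₁ ≠ x₂) (hμ : μ₁ ≠ μ₂) (h₁ : HasFirstMoment μ₁) (h₂ : HasFirstMoment μ₂) :
    ∫⁻ z, ‖f x₁ μ₁ z - f x₂ μ₂ z‖ₑ ∂(θ : Measure (Euc m)) ≤
      (∫⁻ z, lipBound f z ∂(θ : Measure (Euc m))) *
        (edist x₁ x₂ + wasserstein1 (μ₁ : Measure (Euc d)) (μ₂ : Measure (Euc d))) := by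
  rw [← lintegral_mul_const' _ _
    (ENNReal.add_ne_top.2 ⟨edist_ne_top _ _, wasserstein1_ne_top h₁ h₂⟩)]
  exact lintegral_mono fun z => enorm_sub_le_lipBound_mul hx hμ h₁ h₂ z

/-- Equal measures are excluded from the supremum, so a detour is made through a nearby point and a
nearby translate of `μ`, both of which differ from the endpoints; the detour then shrinks to
nothing. -/
theorem lintegral_enorm_sub_le_of_eq_measure
    (hf : Measurable fun p : Euc d × ProbabilityMeasure (Euc d) × Euc m => f p.1 p.2.1 p.2.2)
    (hσ : ∫⁻ z, lipBound f z ∂(θ : Measure (Euc m)) ≠ ∞) (x₁ x₂ : Euc d)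
    {μ : ProbabilityMeasure (Euc d)} (h : HasFirstMoment μ) :
    ∫⁻ z, ‖f x₁ μ z - f x₂ μ z‖ₑ ∂(θ : Measure (Euc m)) ≤
      (∫⁻ z, lipBound f z ∂(θ : Measure (Euc m))) * edist x₁ x₂ := by
  rcases eq_or_ne x₁ x₂ with rfl | hx
  · simp
  -- The two legs of the detour add `‖v‖` four times in all.
  refine le_mul_of_forall_pos_le hσ (K := 4 * edist x₁ x₂)
    (ENNReal.mul_ne_top (by norm_num) (edist_ne_top _ _)) fun c hc => ?_
  -- Pointing away from `x₂`, so that `x₁ + v` cannot hit it.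
  set v : Euc d := (c : ℝ) • (x₁ - x₂) with hv
  have hc' : (c : ℝ) ≠ 0 := by exact_mod_cast hc.ne'
  have hv0 : v ≠ 0 := smul_ne_zero hc' (sub_ne_zero.2 hx)
  have hvn : ‖v‖ₑ = c * edist x₁ x₂ := by
    rw [hv, enorm_smul, edist_eq_enorm_sub]; simp
  obtain ⟨μ', hne, h', hW⟩ := exists_translate h hv0
  have hx₁ : x₁ ≠ x₁ + v := by simpa using hv0
  have hx₂ : x₁ + v ≠ x₂ := by
    intro h
    have e : (1 + (c : ℝ)) • (x₁ - x₂) = 0 := by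
      rw [add_smul, one_smul, ← hv, ← h]; abel_nf
    rcases smul_eq_zero.1 e with h1 | h1
    · have : (0 : ℝ) ≤ c := c.2
      linarith
    · exact hx (sub_eq_zero.1 h1)
  have e₁ : edist x₁ (x₁ + v) = ‖v‖ₑ := by simp [edist_eq_enorm_sub]
  have e₂ : edist (x₁ + v) x₂ ≤ ‖v‖ₑ + edist x₁ x₂ := by
    refine (edist_triangle _ x₁ _).trans ?_
    rw [edist_comm, e₁]
  refine (lintegral_enorm_sub_triangle hf x₁ (x₁ + v) x₂ μ μ' μ).trans ?_
  calc _ ≤ (∫⁻ z, lipBound f z ∂(θ : Measure (Euc m))) * (‖v‖ₑ + ‖v‖ₑ) +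
        (∫⁻ z, lipBound f z ∂(θ : Measure (Euc m))) * (‖v‖ₑ + edist x₁ x₂ + ‖v‖ₑ) := by
        refine add_le_add ((lintegral_enorm_sub_le_of_ne hx₁ hne.symm h h').trans ?_)
          ((lintegral_enorm_sub_le_of_ne hx₂ hne h' h).trans ?_)
        · rw [e₁]; gcongr
        · rw [wasserstein1_comm]; gcongr
    _ = _ := by rw [hvn]; ring

/-- The mean Lipschitz bound, including the pairs that the supremum in `lipBound` leaves out. -/
theorem lintegral_enorm_sub_le
    (hf : Measurable fun p : Euc d × ProbabilityMeasure (Euc d) × Euc m => f p.1 p.2.1 p.2.2)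
    (hσ : ∫⁻ z, lipBound f z ∂(θ : Measure (Euc m)) ≠ ∞) (x₁ x₂ : Euc d)
    {μ₁ μ₂ : ProbabilityMeasure (Euc d)} (h₁ : HasFirstMoment μ₁) (h₂ : HasFirstMoment μ₂) :
    ∫⁻ z, ‖f x₁ μ₁ z - f x₂ μ₂ z‖ₑ ∂(θ : Measure (Euc m)) ≤
      (∫⁻ z, lipBound f z ∂(θ : Measure (Euc m))) *
        (edist x₁ x₂ + wasserstein1 (μ₁ : Measure (Euc d)) (μ₂ : Measure (Euc d))) := by
  rcases eq_or_ne μ₁ μ₂ with rfl | hμ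
  · rw [wasserstein1_self, add_zero]
    exact lintegral_enorm_sub_le_of_eq_measure hf hσ x₁ x₂ h₁
  rcases ne_or_eq x₁ x₂ with hx | rfl
  · exact lintegral_enorm_sub_le_of_ne hx hμ h₁ h₂
  -- For `d = 0` there is no other point to move to, but then `f` is constant.
  rcases subsingleton_or_nontrivial (Euc d) with hs | hn
  · simp [Subsingleton.elim (f x₁ μ₁ _ - f x₁ μ₂ _) 0]
  obtain ⟨v, hv⟩ := exists_ne (0 : Euc d)
  rw [edist_self, zero_add]
  refine le_mul_of_forall_pos_le hσ (K := 2 * ‖v‖ₑ)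
    (ENNReal.mul_ne_top (by norm_num) enorm_ne_top) fun c hc => ?_
  have hx : x₁ ≠ x₁ + (c : ℝ) • v := by simpa [hv] using hc.ne'
  have e : edist x₁ (x₁ + (c : ℝ) • v) = c * ‖v‖ₑ := by
    simp [edist_eq_enorm_sub, enorm_smul]
  refine (lintegral_enorm_sub_triangle hf x₁ (x₁ + (c : ℝ) • v) x₁ μ₁ μ₂ μ₂).trans ?_
  refine (add_le_add (lintegral_enorm_sub_le_of_ne hx hμ h₁ h₂)
    (lintegral_enorm_sub_le_of_eq_measure hf hσ _ _ h₂)).trans (le_of_eq ?_)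
  rw [edist_comm _ x₁, e]
  ring

end Lipschitz

/-! ### Mean contractions and the fixed point of the nonlinear evolution. -/

/-- The one-step map `G` contracts in mean: its expected displacement is controlled by `a` times
the distance of the states plus `b` times the distance of the laws, where `a + b < 1`. -/
structure IsMeanContraction {d m : ℕ} (G : Euc d → ProbabilityMeasure (Euc d) → Euc m → Euc d)
    (θ : ProbabilityMeasure (Euc m)) (a b : ℝ≥0∞) : Prop where
  measurable : Measurable fun p : Euc d × ProbabilityMeasure (Euc d) × Euc m => G p.1 p.2.1 p.2.2
  lintegral_edist_le : ∀ (x₁ x₂ : Euc d) {μ₁ μ₂ : ProbabilityMeasure (Euc d)},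
    HasFirstMoment μ₁ → HasFirstMoment μ₂ →
      ∫⁻ z, edist (G x₁ μ₁ z) (G x₂ μ₂ z) ∂(θ : Measure (Euc m)) ≤
        a * edist x₁ x₂ + b * wasserstein1 (μ₁ : Measure (Euc d)) (μ₂ : Measure (Euc d))
  lintegral_origin_lt_top : ∫⁻ z, ‖G 0 (diracZero d) z‖ₑ ∂(θ : Measure (Euc m)) < ∞
  add_lt_one : a + b < 1

namespace IsMeanContraction

variable {d m : ℕ} {G : Euc d → ProbabilityMeasure (Euc d) → Euc m → Euc d}
  {θ : ProbabilityMeasure (Euc m)} {a b : ℝ≥0∞}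

theorem left_ne_top (hG : IsMeanContraction G θ a b) : a ≠ ∞ :=
  ((le_self_add.trans_lt hG.add_lt_one).trans ENNReal.one_lt_top).ne

theorem right_ne_top (hG : IsMeanContraction G θ a b) : b ≠ ∞ :=
  ((le_add_self.trans_lt hG.add_lt_one).trans ENNReal.one_lt_top).ne

theorem measurable_comp (hG : IsMeanContraction G θ a b) {Ω : Type*} [MeasurableSpace Ω]
    {X : Ω → Euc d} {M : Ω → ProbabilityMeasure (Euc d)} {Z : Ω → Euc m} (hX : Measurable X)
    (hM : Measurable M) (hZ : Measurable Z) : Measurable fun w => G (X w) (M w) (Z w) :=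
  hG.measurable.comp (hX.prodMk (hM.prodMk hZ))

section FixedPoint

/-- Start from a nearly optimal coupling of `μ` and `ν` and apply one common noise to both
components. -/
theorem wasserstein1_next_le (hG : IsMeanContraction G θ a b) {μ ν : ProbabilityMeasure (Euc d)}
    (hμ : HasFirstMoment μ) (hν : HasFirstMoment ν) :
    wasserstein1
        (((μ : Measure (Euc d)).prod (θ : Measure (Euc m))).map fun p => G p.1 μ p.2)
        (((ν : Measure (Euc d)).prod (θ : Measure (Euc m))).map fun p => G p.1 ν p.2) ≤
      (a + b) * wasserstein1 (μ : Measure (Euc d)) (ν : Measure (Euc d)) := by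
  set W := wasserstein1 (μ : Measure (Euc d)) (ν : Measure (Euc d)) with hWdef
  have hW : W ≠ ∞ := wasserstein1_ne_top hμ hν
  have hb := hG.right_ne_top
  refine le_mul_of_forall_pos_le (K := 1)
    (ENNReal.add_ne_top.2 ⟨hG.left_ne_top, hb⟩) ENNReal.one_ne_top fun c hc => ?_
  rw [mul_one]
  obtain ⟨π, h₁, h₂, h₃⟩ := exists_coupling_of_wasserstein1_lt
    (ENNReal.lt_add_right hW (b := c) (by exact_mod_cast hc.ne'))
  have hπ := isProbabilityMeasure_of_map_fst h₁
  have m₁ : Measurable fun p : Euc d × Euc m => G p.1 μ p.2 :=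
    hG.measurable_comp measurable_fst measurable_const measurable_snd
  have m₂ : Measurable fun p : Euc d × Euc m => G p.1 ν p.2 :=
    hG.measurable_comp measurable_fst measurable_const measurable_snd
  have n₁ : Measurable fun q : (Euc d × Euc d) × Euc m => G q.1.1 μ q.2 :=
    m₁.comp (by fun_prop : Measurable fun q : (Euc d × Euc d) × Euc m => (q.1.1, q.2))
  have n₂ : Measurable fun q : (Euc d × Euc d) × Euc m => G q.1.2 ν q.2 :=
    m₂.comp (by fun_prop : Measurable fun q : (Euc d × Euc d) × Euc m => (q.1.2, q.2))
  have e₁ : (π.prod (θ : Measure (Euc m))).map (fun q => G q.1.1 μ q.2) =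
      ((μ : Measure (Euc d)).prod (θ : Measure (Euc m))).map fun p => G p.1 μ p.2 := by
    conv_rhs => rw [← h₁, ← Measure.map_id (μ := (θ : Measure (Euc m))),
      Measure.map_prod_map _ _ measurable_fst measurable_id,
      Measure.map_map m₁ (by fun_prop)]
    rfl
  have e₂ : (π.prod (θ : Measure (Euc m))).map (fun q => G q.1.2 ν q.2) =
      ((ν : Measure (Euc d)).prod (θ : Measure (Euc m))).map fun p => G p.1 ν p.2 := by
    conv_rhs => rw [← h₂, ← Measure.map_id (μ := (θ : Measure (Euc m))),
      Measure.map_prod_map _ _ measurable_snd measurable_id,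
      Measure.map_map m₂ (by fun_prop)]
    rfl
  rw [← e₁, ← e₂]
  calc _ ≤ ∫⁻ q, edist (G q.1.1 μ q.2) (G q.1.2 ν q.2) ∂(π.prod (θ : Measure (Euc m))) :=
        wasserstein1_map_map_le _ n₁ n₂
    _ = ∫⁻ p, ∫⁻ z, edist (G p.1 μ z) (G p.2 ν z) ∂(θ : Measure (Euc m)) ∂π :=
        lintegral_prod _ (n₁.edist n₂).aemeasurable
    _ ≤ ∫⁻ p, (a * edist p.1 p.2 + b * W) ∂π :=
        lintegral_mono fun p => hG.lintegral_edist_le p.1 p.2 hμ hν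
    _ = a * (∫⁻ p, edist p.1 p.2 ∂π) + b * W := by
        rw [lintegral_add_right _ measurable_const, lintegral_const_mul _ (by fun_prop),
          lintegral_const, measure_univ, mul_one]
    _ ≤ a * (W + c) + b * (W + c) := by gcongr; exact le_self_add
    _ = _ := by ring

theorem eq_of_next_eq (hG : IsMeanContraction G θ a b) {μ ν : ProbabilityMeasure (Euc d)}
    (hμ : HasFirstMoment μ) (hν : HasFirstMoment ν)
    (h₁ : ((μ : Measure (Euc d)).prod (θ : Measure (Euc m))).map (fun p => G p.1 μ p.2) = μ)
    (h₂ : ((ν : Measure (Euc d)).prod (θ : Measure (Euc m))).map (fun p => G p.1 ν p.2) = ν) :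
    μ = ν := by
  have h := hG.wasserstein1_next_le hμ hν
  rw [h₁, h₂] at h
  refine Subtype.ext (eq_of_wasserstein1_eq_zero (μ := (μ : Measure (Euc d)))
    (ν := (ν : Measure (Euc d))) ?_)
  by_contra h0
  have := ENNReal.mul_lt_mul_left h0 (wasserstein1_ne_top hμ hν) hG.add_lt_one
  rw [one_mul] at this
  exact absurd h (not_le.2 this)

variable {Z Z' : (ℕ → Euc m) → Euc d}

/-- The law of `Z` when the noises are i.i.d. with law `θ`. -/
noncomputable def lawOf (θ : ProbabilityMeasure (Euc m)) (Z : (ℕ → Euc m) → Euc d)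
    (hZ : Measurable Z) : ProbabilityMeasure (Euc d) :=
  ⟨(Measure.infinitePi fun _ : ℕ => (θ : Measure (Euc m))).map Z,
    Measure.isProbabilityMeasure_map hZ.aemeasurable⟩

/-- Run the one-step map with the first noise, starting from the value of `Z` at the
remaining noises. -/
noncomputable def unroll (G : Euc d → ProbabilityMeasure (Euc d) → Euc m → Euc d)
    (θ : ProbabilityMeasure (Euc m)) (Z : (ℕ → Euc m) → Euc d) (hZ : Measurable Z)
    (e : ℕ → Euc m) : Euc d :=
  G (Z fun n => e (n + 1)) (lawOf θ Z hZ) (e 0)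

theorem measurable_unroll (hG : IsMeanContraction G θ a b) (hZ : Measurable Z) :
    Measurable (unroll G θ Z hZ) :=
  hG.measurable_comp (hZ.comp (by fun_prop)) measurable_const (by fun_prop)

theorem hasFirstMoment_lawOf (hZ : Measurable Z)
    (h : ∫⁻ e, ‖Z e‖ₑ ∂(Measure.infinitePi fun _ : ℕ => (θ : Measure (Euc m))) < ∞) :
    HasFirstMoment (lawOf θ Z hZ) := by
  change ∫⁻ x, ‖x‖ₑ ∂(Measure.map Z _) < ∞
  rwa [lintegral_map (by fun_prop) hZ]

/-- The first noise is independent of the tail and can be integrated out first. The distance of the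
laws is at most the `L¹` distance, since `Z` and `Z'` live on one space. -/
theorem lintegral_edist_unroll_le (hG : IsMeanContraction G θ a b) (hZ : Measurable Z)
    (hZ' : Measurable Z')
    (h : ∫⁻ e, ‖Z e‖ₑ ∂(Measure.infinitePi fun _ : ℕ => (θ : Measure (Euc m))) < ∞)
    (h' : ∫⁻ e, ‖Z' e‖ₑ ∂(Measure.infinitePi fun _ : ℕ => (θ : Measure (Euc m))) < ∞) :
    ∫⁻ e, edist (unroll G θ Z hZ e) (unroll G θ Z' hZ' e)
        ∂(Measure.infinitePi fun _ : ℕ => (θ : Measure (Euc m))) ≤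
      (a + b) * ∫⁻ e, edist (Z e) (Z' e)
        ∂(Measure.infinitePi fun _ : ℕ => (θ : Measure (Euc m))) := by
  set Θ := Measure.infinitePi fun _ : ℕ => (θ : Measure (Euc m))
  have n : ∀ {Y : (ℕ → Euc m) → Euc d} (ρ : ProbabilityMeasure (Euc d)), Measurable Y →
      Measurable fun p : Euc m × (ℕ → Euc m) => G (Y p.2) ρ p.1 := fun ρ hY =>
    hG.measurable_comp (hY.comp measurable_snd) measurable_const measurable_fst
  have hm : Measurable fun p : Euc m × (ℕ → Euc m) =>
      edist (G (Z p.2) (lawOf θ Z hZ) p.1) (G (Z' p.2) (lawOf θ Z' hZ') p.1) :=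
    (n _ hZ).edist (n _ hZ')
  have hW : wasserstein1 (lawOf θ Z hZ : Measure (Euc d)) (lawOf θ Z' hZ' : Measure (Euc d)) ≤
      ∫⁻ e, edist (Z e) (Z' e) ∂Θ := wasserstein1_map_map_le Θ hZ hZ'
  calc ∫⁻ e, edist (unroll G θ Z hZ e) (unroll G θ Z' hZ' e) ∂Θ
      = ∫⁻ e, ∫⁻ z, edist (G (Z e) (lawOf θ Z hZ) z) (G (Z' e) (lawOf θ Z' hZ') z)
          ∂(θ : Measure (Euc m)) ∂Θ :=
        lintegral_infinitePi_head_tail (θ : Measure (Euc m)) (g := fun z e =>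
          edist (G (Z e) (lawOf θ Z hZ) z) (G (Z' e) (lawOf θ Z' hZ') z)) hm
    _ ≤ ∫⁻ e, (a * edist (Z e) (Z' e) + b * wasserstein1 (lawOf θ Z hZ : Measure (Euc d))
          (lawOf θ Z' hZ' : Measure (Euc d))) ∂Θ :=
        lintegral_mono fun e => hG.lintegral_edist_le _ _ (hasFirstMoment_lawOf hZ h)
          (hasFirstMoment_lawOf hZ' h')
    _ = a * (∫⁻ e, edist (Z e) (Z' e) ∂Θ) + b * wasserstein1 (lawOf θ Z hZ : Measure (Euc d))
          (lawOf θ Z' hZ' : Measure (Euc d)) := by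
        rw [lintegral_add_right _ measurable_const, lintegral_const_mul _ (hZ.edist hZ'),
          lintegral_const, measure_univ, mul_one]
    _ ≤ a * (∫⁻ e, edist (Z e) (Z' e) ∂Θ) + b * ∫⁻ e, edist (Z e) (Z' e) ∂Θ := by gcongr
    _ = _ := (add_mul _ _ _).symm

/-- Compare with the zero variable, whose law is `diracZero d` and whose image is integrable by
assumption on `G`. -/
theorem lintegral_enorm_unroll_lt_top (hG : IsMeanContraction G θ a b) (hZ : Measurable Z)
    (h : ∫⁻ e, ‖Z e‖ₑ ∂(Measure.infinitePi fun _ : ℕ => (θ : Measure (Euc m))) < ∞) :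
    ∫⁻ e, ‖unroll G θ Z hZ e‖ₑ ∂(Measure.infinitePi fun _ : ℕ => (θ : Measure (Euc m))) < ∞ := by
  set Θ := Measure.infinitePi fun _ : ℕ => (θ : Measure (Euc m)) with hΘ
  set O : (ℕ → Euc m) → Euc d := fun _ => 0
  have hO : Measurable O := measurable_const
  have hlaw : lawOf θ O hO = diracZero d := Subtype.ext (by
    change Measure.map (fun _ => (0 : Euc d)) _ = Measure.dirac 0
    rw [Measure.map_const, measure_univ, one_smul])
  have hG0 : Measurable fun z => G 0 (diracZero d) z :=
    hG.measurable_comp measurable_const measurable_const measurable_id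
  have h0 : ∫⁻ e, ‖unroll G θ O hO e‖ₑ ∂Θ < ∞ := by
    have : ∀ e, unroll G θ O hO e = G 0 (diracZero d) (e 0) := fun e => by rw [unroll, hlaw]
    simp_rw [this]
    have e := (measurePreserving_eval_infinitePi (fun _ : ℕ => (θ : Measure (Euc m)))
      0).lintegral_comp (f := fun z => ‖G 0 (diracZero d) z‖ₑ) hG0.enorm
    rw [hΘ]
    exact (le_of_eq e).trans_lt hG.lintegral_origin_lt_top
  have hd := hG.lintegral_edist_unroll_le hZ hO h (by simp [O])
  calc ∫⁻ e, ‖unroll G θ Z hZ e‖ₑ ∂Θ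
      ≤ ∫⁻ e, (edist (unroll G θ Z hZ e) (unroll G θ O hO e) + ‖unroll G θ O hO e‖ₑ) ∂Θ := by
        refine lintegral_mono fun e => ?_
        simp only [← edist_zero_right]
        exact edist_triangle _ _ _
    _ = (∫⁻ e, edist (unroll G θ Z hZ e) (unroll G θ O hO e) ∂Θ) +
          ∫⁻ e, ‖unroll G θ O hO e‖ₑ ∂Θ :=
        lintegral_add_right _ (hG.measurable_unroll hO).enorm
    _ < ∞ := by
        refine ENNReal.add_lt_top.2 ⟨hd.trans_lt ?_, h0⟩
        refine ENNReal.mul_lt_top (hG.add_lt_one.trans ENNReal.one_lt_top) ?_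
        simpa [O] using h

/-- The nonlinear evolution has a fixed point, by Banach's theorem in `L¹` of the noise. -/
theorem exists_next_eq (hG : IsMeanContraction G θ a b) :
    ∃ μ : ProbabilityMeasure (Euc d), HasFirstMoment μ ∧
      ((μ : Measure (Euc d)).prod (θ : Measure (Euc m))).map (fun p => G p.1 μ p.2) = μ := by
  set Θ := Measure.infinitePi fun _ : ℕ => (θ : Measure (Euc m)) with hΘ
  have hmeas : ∀ Z : Lp (Euc d) 1 Θ, Measurable (Z : (ℕ → Euc m) → Euc d) := fun Z =>
    (Lp.stronglyMeasurable Z).measurable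
  have hmom : ∀ Z : Lp (Euc d) 1 Θ, ∫⁻ e, ‖Z e‖ₑ ∂Θ < ∞ := fun Z => by
    rw [← eLpNorm_one_eq_lintegral_enorm]; exact (Lp.memLp Z).2
  have hmem : ∀ Z : Lp (Euc d) 1 Θ, MemLp (unroll G θ Z (hmeas Z)) 1 Θ := fun Z =>
    ⟨(hG.measurable_unroll (hmeas Z)).aestronglyMeasurable, by
      rw [eLpNorm_one_eq_lintegral_enorm]
      exact hG.lintegral_enorm_unroll_lt_top (hmeas Z) (hmom Z)⟩
  set U : Lp (Euc d) 1 Θ → Lp (Euc d) 1 Θ := fun Z => (hmem Z).toLp _ with hU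
  have hab : a + b ≠ ∞ := (hG.add_lt_one.trans ENNReal.one_lt_top).ne
  have hcontr : ContractingWith (a + b).toNNReal U := by
    refine ⟨?_, fun Z Z' => ?_⟩
    · rw [← ENNReal.coe_lt_coe, ENNReal.coe_toNNReal hab]
      exact hG.add_lt_one
    · rw [ENNReal.coe_toNNReal hab, hU, Lp.edist_toLp_toLp, Lp.edist_def,
        eLpNorm_one_eq_lintegral_enorm, eLpNorm_one_eq_lintegral_enorm]
      simp only [Pi.sub_apply, ← edist_eq_enorm_sub]
      exact hG.lintegral_edist_unroll_le (hmeas Z) (hmeas Z') (hmom Z) (hmom Z')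
  set Z := hcontr.fixedPoint U
  have hfix : U Z = Z := hcontr.fixedPoint_isFixedPt
  -- The fixed-point equation holds only almost everywhere, which is enough for laws.
  have hae : (Z : (ℕ → Euc m) → Euc d) =ᵐ[Θ] unroll G θ Z (hmeas Z) := by
    have h := (hmem Z).coeFn_toLp
    change (U Z : (ℕ → Euc m) → Euc d) =ᵐ[Θ] _ at h
    rwa [hfix] at h
  refine ⟨lawOf θ Z (hmeas Z), hasFirstMoment_lawOf (hmeas Z) (hmom Z), ?_⟩
  set ρ := lawOf θ Z (hmeas Z) with hρ
  have m₁ : Measurable fun p : Euc d × Euc m => G p.1 ρ p.2 :=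
    hG.measurable_comp measurable_fst measurable_const measurable_snd
  -- The shifted `Z` has law `ρ` and is independent of the first noise, so the law of `unroll` is
  -- the next law after `ρ`.
  have e₁ : (ρ : Measure (Euc d)).prod (θ : Measure (Euc m)) =
      Θ.map fun e => (Z fun n => e (n + 1), e 0) := by
    have h := infinitePi_map_head_tail (θ : Measure (Euc m))
    change (Θ.map Z).prod (θ : Measure (Euc m)) = _
    conv_lhs => rw [← Measure.map_id (μ := (θ : Measure (Euc m)))]
    rw [Measure.map_prod_map _ _ (hmeas Z) measurable_id, ← Measure.prod_swap, ← h,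
      Measure.map_map (by fun_prop) (by fun_prop),
      Measure.map_map (((hmeas Z).prodMap measurable_id).comp measurable_swap) (by fun_prop)]
    rfl
  have hshift : Measurable fun e : ℕ → Euc m => Z fun n => e (n + 1) :=
    (hmeas Z).comp (by fun_prop : Measurable fun (e : ℕ → Euc m) (n : ℕ) => e (n + 1))
  rw [e₁, Measure.map_map m₁ (hshift.prodMk (measurable_pi_apply 0))]
  exact (Measure.map_congr hae).symm

end FixedPoint

end IsMeanContraction

/-! ### Independence of the state from future noise. -/

section NoiseDriven

variable {Ω S T : Type*} [MeasurableSpace Ω] [MeasurableSpace S] [MeasurableSpace T]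

/-- If the state is independent of an i.i.d. sequence of noises, then the state updated with the
first noise is independent of the remaining ones. -/
theorem map_update_noise (P : Measure Ω) [IsProbabilityMeasure P] (τ : Measure T)
    [IsProbabilityMeasure τ] {X X' : Ω → S} {E : Ω → ℕ → T} {Φ : S × T → S} (hX : Measurable X)
    (hE : Measurable E) (hΦ : Measurable Φ) (hX' : ∀ w, X' w = Φ (X w, E w 0))
    (h : P.map (fun w => (X w, E w)) = (P.map X).prod (Measure.infinitePi fun _ : ℕ => τ)) :
    P.map X' = ((P.map X).prod τ).map Φ ∧
      P.map (fun w => (X' w, fun n => E w (n + 1))) =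
        (P.map X').prod (Measure.infinitePi fun _ : ℕ => τ) := by
  obtain rfl : X' = fun w => Φ (X w, E w 0) := funext hX'
  have hLX : IsProbabilityMeasure (P.map X) := Measure.isProbabilityMeasure_map hX.aemeasurable
  have hL' : IsProbabilityMeasure (((P.map X).prod τ).map Φ) :=
    Measure.isProbabilityMeasure_map hΦ.aemeasurable
  have hE0 : Measurable fun w => E w 0 := (measurable_pi_apply 0).comp hE
  have hE' : Measurable fun w n => E w (n + 1) :=
    (by fun_prop : Measurable fun (e : ℕ → T) (n : ℕ) => e (n + 1)).comp hE
  have hXm : Measurable fun w => Φ (X w, E w 0) := hΦ.comp (hX.prodMk hE0)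
  set Θ := Measure.infinitePi fun _ : ℕ => τ with hΘ
  have hht : Measurable fun e : ℕ → T => (e 0, fun n => e (n + 1)) := by fun_prop
  have hsplit : P.map (fun w => ((X w, E w 0), fun n => E w (n + 1))) =
      ((P.map X).prod τ).prod Θ := by
    rw [← (MeasurableEquiv.prodAssoc (α := S) (β := T)
      (γ := ℕ → T)).map_measurableEquiv_injective.eq_iff, Measure.prodAssoc_prod,
      Measure.map_map (MeasurableEquiv.measurable _) ((hX.prodMk hE0).prodMk hE'), hΘ,
      ← infinitePi_map_head_tail τ]
    conv_rhs => rw [← Measure.map_id (μ := P.map X)]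
    rw [Measure.map_prod_map _ _ measurable_id hht, ← h,
      Measure.map_map (measurable_id.prodMap hht) (hX.prodMk hE)]
    rfl
  have hjoint : P.map (fun w => (Φ (X w, E w 0), fun n => E w (n + 1))) =
      (((P.map X).prod τ).map Φ).prod Θ := by
    conv_rhs => rw [← Measure.map_id (μ := Θ)]
    rw [Measure.map_prod_map _ _ hΦ measurable_id, ← hsplit,
      Measure.map_map (hΦ.prodMap measurable_id) ((hX.prodMk hE0).prodMk hE')]
    rfl
  have hfst : P.map (fun w => Φ (X w, E w 0)) = ((P.map X).prod τ).map Φ := by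
    have := congrArg (Measure.map Prod.fst) hjoint
    rw [Measure.map_map measurable_fst (hXm.prodMk hE'), Measure.map_fst_prod, measure_univ,
      one_smul] at this
    exact this
  exact ⟨hfst, by rw [hjoint, hfst]⟩

end NoiseDriven

/-! ### Coupling the particles with independent nonlinear processes. -/

/-- One step of the interacting particles. -/
noncomputable def particleStep {d m : ℕ} (G : Euc d → ProbabilityMeasure (Euc d) → Euc m → Euc d)
    (N : ℕ+) (p : (Fin N → Euc d) × (Fin N → Euc m)) (i : Fin N) : Euc d :=
  G (p.1 i) (empirical N p.1) (p.2 i)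

namespace IsMeanContraction

variable {d m : ℕ} {G : Euc d → ProbabilityMeasure (Euc d) → Euc m → Euc d}
  {θ : ProbabilityMeasure (Euc m)} {a b : ℝ≥0∞}

theorem measurable_particleStep (hG : IsMeanContraction G θ a b) (N : ℕ+) :
    Measurable (particleStep G N) := by
  refine measurable_pi_lambda _ fun i => hG.measurable_comp (by fun_prop) ?_ (by fun_prop)
  exact (measurable_empirical N).comp measurable_fst

/-- Independent copies of the nonlinear process, started from a fixed point, stay i.i.d. -/
theorem pi_map_next (hG : IsMeanContraction G θ a b) (N : ℕ+) {ν : ProbabilityMeasure (Euc d)}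
    (hfix : ((ν : Measure (Euc d)).prod (θ : Measure (Euc m))).map (fun p => G p.1 ν p.2) = ν) :
    ((Measure.pi fun _ : Fin N => (ν : Measure (Euc d))).prod
      (Measure.pi fun _ : Fin N => (θ : Measure (Euc m)))).map
        (fun p i => G (p.1 i) ν (p.2 i)) = Measure.pi fun _ : Fin N => (ν : Measure (Euc d)) := by
  have m₁ : Measurable fun p : Euc d × Euc m => G p.1 ν p.2 :=
    hG.measurable_comp measurable_fst measurable_const measurable_snd
  have hm : Measurable fun (p : (Fin N → Euc d) × (Fin N → Euc m)) (i : Fin N) =>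
      G (p.1 i) ν (p.2 i) :=
    measurable_pi_lambda _ fun i => hG.measurable_comp (by fun_prop) measurable_const (by fun_prop)
  -- Viewed as a tuple of pairs, the input is i.i.d. and the map acts coordinatewise.
  rw [← (measurePreserving_arrowProdEquivProdArrow (Euc d) (Euc m) (Fin N)
    (fun _ => (ν : Measure (Euc d))) (fun _ => (θ : Measure (Euc m)))).map_eq,
    Measure.map_map hm (MeasurableEquiv.measurable _)]
  have hp : IsProbabilityMeasure
      (((ν : Measure (Euc d)).prod (θ : Measure (Euc m))).map fun p => G p.1 ν p.2) :=
    Measure.isProbabilityMeasure_map m₁.aemeasurable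
  have h := Measure.pi_map_pi (ι := Fin N)
    (μ := fun _ => (ν : Measure (Euc d)).prod (θ : Measure (Euc m)))
    (f := fun _ p => G p.1 ν p.2) fun _ => m₁.aemeasurable
  simp only [hfix] at h
  exact h

/-- Both systems receive the same noises; the first sees its empirical measure, the second sees `ν`.
The discrepancy of these measures is at most the average distance plus the sampling error of the
second system, which turns the factor `a` into `a + b`. -/
theorem exists_coupling_step (hG : IsMeanContraction G θ a b) (N : ℕ+)
    {ν : ProbabilityMeasure (Euc d)} (hν : HasFirstMoment ν)
    (hfix : ((ν : Measure (Euc d)).prod (θ : Measure (Euc m))).map (fun p => G p.1 ν p.2) = ν)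
    {π : Measure ((Fin N → Euc d) × (Fin N → Euc d))} [IsProbabilityMeasure π]
    (hπ : π.map Prod.snd = Measure.pi fun _ : Fin N => (ν : Measure (Euc d))) :
    ∃ π' : Measure ((Fin N → Euc d) × (Fin N → Euc d)),
      π'.map Prod.fst = ((π.map Prod.fst).prod
        (Measure.pi fun _ : Fin N => (θ : Measure (Euc m)))).map (particleStep G N) ∧
      π'.map Prod.snd = (Measure.pi fun _ : Fin N => (ν : Measure (Euc d))) ∧
      ∫⁻ p, ((N : ℕ) : ℝ≥0∞)⁻¹ * ∑ i, edist (p.1 i) (p.2 i) ∂π' ≤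
        (a + b) * (∫⁻ p, ((N : ℕ) : ℝ≥0∞)⁻¹ * ∑ i, edist (p.1 i) (p.2 i) ∂π) +
          b * ∫⁻ y, wasserstein1 (empirical N y : Measure (Euc d)) (ν : Measure (Euc d))
            ∂(Measure.pi fun _ : Fin N => (ν : Measure (Euc d))) := by
  set τ := Measure.pi fun _ : Fin N => (θ : Measure (Euc m)) with hτ
  have hpi : IsProbabilityMeasure (π.map Prod.fst) :=
    Measure.isProbabilityMeasure_map measurable_fst.aemeasurable
  have hs := hG.measurable_particleStep N
  have hn : Measurable fun (p : (Fin N → Euc d) × (Fin N → Euc m)) (i : Fin N) =>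
      G (p.1 i) ν (p.2 i) :=
    measurable_pi_lambda _ fun i => hG.measurable_comp (by fun_prop) measurable_const (by fun_prop)
  set F : ((Fin N → Euc d) × (Fin N → Euc d)) × (Fin N → Euc m) → Fin N → Euc d :=
    fun q => particleStep G N (q.1.1, q.2) with hF
  set F' : ((Fin N → Euc d) × (Fin N → Euc d)) × (Fin N → Euc m) → Fin N → Euc d :=
    fun q i => G (q.1.2 i) ν (q.2 i) with hF'
  have hFm : Measurable F := hs.comp (by fun_prop)
  have hF'm : Measurable F' := hn.comp
    (by fun_prop : Measurable fun q : ((Fin N → Euc d) × (Fin N → Euc d)) × (Fin N → Euc m) =>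
      (q.1.2, q.2))
  refine ⟨(π.prod τ).map fun q => (F q, F' q), ?_, ?_, ?_⟩
  · rw [Measure.map_map measurable_fst (hFm.prodMk hF'm)]
    conv_rhs => rw [← Measure.map_id (μ := τ)]
    rw [Measure.map_prod_map _ _ measurable_fst measurable_id,
      Measure.map_map hs (measurable_fst.prodMap measurable_id)]
    rfl
  · rw [Measure.map_map measurable_snd (hFm.prodMk hF'm)]
    have h := hG.pi_map_next N hfix
    rw [← hπ] at h
    conv_rhs => rw [← hπ, ← h, ← hτ, ← Measure.map_id (μ := τ)]
    rw [Measure.map_prod_map _ _ measurable_snd measurable_id,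
      Measure.map_map hn (measurable_snd.prodMap measurable_id)]
    rfl
  · have hw := measurable_wasserstein1_empirical N ν
    have hFi : ∀ i, Measurable fun q => F q i := fun i => (measurable_pi_apply i).comp hFm
    have hF'i : ∀ i, Measurable fun q => F' q i := fun i => (measurable_pi_apply i).comp hF'm
    have hterm : ∀ i, ∫⁻ q, edist (F q i) (F' q i) ∂(π.prod τ) ≤
        ∫⁻ p, (a * edist (p.1 i) (p.2 i) + b *
          wasserstein1 (empirical N p.1 : Measure (Euc d)) (ν : Measure (Euc d))) ∂π := by
      intro i
      rw [lintegral_prod _ ((hFi i).edist (hF'i i)).aemeasurable]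
      refine lintegral_mono fun p => ?_
      have hg : Measurable fun z : Euc m => edist (G (p.1 i) (empirical N p.1) z) (G (p.2 i) ν z) :=
        (hG.measurable_comp measurable_const measurable_const measurable_id).edist
          (hG.measurable_comp measurable_const measurable_const measurable_id)
      refine (le_of_eq ?_).trans
        (hG.lintegral_edist_le (p.1 i) (p.2 i) (hasFirstMoment_empirical N p.1) hν)
      exact (measurePreserving_eval (fun _ : Fin N => (θ : Measure (Euc m))) i).lintegral_comp hg
    have hav : Measurable fun p : (Fin N → Euc d) × (Fin N → Euc d) =>
        ((N : ℕ) : ℝ≥0∞)⁻¹ * ∑ i, edist (p.1 i) (p.2 i) := by fun_prop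
    have hw₁ : Measurable fun p : (Fin N → Euc d) × (Fin N → Euc d) =>
        wasserstein1 (empirical N p.1 : Measure (Euc d)) (ν : Measure (Euc d)) :=
      hw.comp measurable_fst
    have hw₂ : Measurable fun p : (Fin N → Euc d) × (Fin N → Euc d) =>
        wasserstein1 (empirical N p.2 : Measure (Euc d)) (ν : Measure (Euc d)) :=
      hw.comp measurable_snd
    rw [lintegral_map hav (hFm.prodMk hF'm), lintegral_const_mul' _ _ (inv_card_ne_top N),
      lintegral_finsetSum _ fun i _ => (hFi i).edist (hF'i i), ← hπ,
      lintegral_map hw measurable_snd]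
    calc _ ≤ ((N : ℕ) : ℝ≥0∞)⁻¹ * ∑ i : Fin N, ∫⁻ p, (a * edist (p.1 i) (p.2 i) + b *
          wasserstein1 (empirical N p.1 : Measure (Euc d)) (ν : Measure (Euc d))) ∂π := by
          gcongr with i; exact hterm i
      _ = ∫⁻ p, ((N : ℕ) : ℝ≥0∞)⁻¹ * ∑ i : Fin N, (a * edist (p.1 i) (p.2 i) + b *
          wasserstein1 (empirical N p.1 : Measure (Euc d)) (ν : Measure (Euc d))) ∂π := by
          rw [lintegral_const_mul' _ _ (inv_card_ne_top N),
            lintegral_finsetSum _ fun i _ => by fun_prop]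
      _ = ∫⁻ p, (a * (((N : ℕ) : ℝ≥0∞)⁻¹ * ∑ i, edist (p.1 i) (p.2 i)) + b *
          wasserstein1 (empirical N p.1 : Measure (Euc d)) (ν : Measure (Euc d))) ∂π := by
          refine lintegral_congr fun p => ?_
          rw [Finset.sum_add_distrib, mul_add, inv_card_mul_sum_const, ← Finset.mul_sum,
            mul_left_comm]
      _ ≤ ∫⁻ p, (a * (((N : ℕ) : ℝ≥0∞)⁻¹ * ∑ i, edist (p.1 i) (p.2 i)) + b *
          (((N : ℕ) : ℝ≥0∞)⁻¹ * ∑ i, edist (p.1 i) (p.2 i) +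
          wasserstein1 (empirical N p.2 : Measure (Euc d)) (ν : Measure (Euc d)))) ∂π := by
          gcongr with p; exact wasserstein1_empirical_left_le N p.1 p.2 ν
      _ = ∫⁻ p, ((a + b) * (((N : ℕ) : ℝ≥0∞)⁻¹ * ∑ i, edist (p.1 i) (p.2 i)) + b *
          wasserstein1 (empirical N p.2 : Measure (Euc d)) (ν : Measure (Euc d))) ∂π :=
          lintegral_congr fun p => by ring
      _ = _ := by
          rw [lintegral_add_left (hav.const_mul _), lintegral_const_mul _ hav,
            lintegral_const_mul _ hw₂]

/-- Iterating the coupling keeps the particles close to an i.i.d. sample of the fixed point. -/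
theorem exists_coupling (hG : IsMeanContraction G θ a b) (N : ℕ+)
    {ν : ProbabilityMeasure (Euc d)} (hν : HasFirstMoment ν)
    (hfix : ((ν : Measure (Euc d)).prod (θ : Measure (Euc m))).map (fun p => G p.1 ν p.2) = ν)
    {L : ℕ → Measure (Fin N → Euc d)} [IsProbabilityMeasure (L 0)]
    (hL : ∀ n, L (n + 1) = ((L n).prod
      (Measure.pi fun _ : Fin N => (θ : Measure (Euc m)))).map (particleStep G N)) (n : ℕ) :
    ∃ π : Measure ((Fin N → Euc d) × (Fin N → Euc d)),
      π.map Prod.fst = L n ∧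
      π.map Prod.snd = (Measure.pi fun _ : Fin N => (ν : Measure (Euc d))) ∧
      ∫⁻ p, ((N : ℕ) : ℝ≥0∞)⁻¹ * ∑ i, edist (p.1 i) (p.2 i) ∂π ≤
        (a + b) ^ n * (∫⁻ x, ((N : ℕ) : ℝ≥0∞)⁻¹ * ∑ i, ‖x i‖ₑ ∂(L 0) +
          ∫⁻ x, ‖x‖ₑ ∂(ν : Measure (Euc d))) + (1 - (a + b))⁻¹ *
        ∫⁻ y, wasserstein1 (empirical N y : Measure (Euc d)) (ν : Measure (Euc d))
          ∂(Measure.pi fun _ : Fin N => (ν : Measure (Euc d))) := by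
  set β := ∫⁻ y, wasserstein1 (empirical N y : Measure (Euc d)) (ν : Measure (Euc d))
    ∂(Measure.pi fun _ : Fin N => (ν : Measure (Euc d)))
  set K := ∫⁻ x, ((N : ℕ) : ℝ≥0∞)⁻¹ * ∑ i, ‖x i‖ₑ ∂(L 0) + ∫⁻ x, ‖x‖ₑ ∂(ν : Measure (Euc d))
    with hK
  induction n with
  | zero =>
    -- Any start of finite cost will do, as this cost is multiplied by `(a + b) ^ n`; the
    -- independent one is taken.
    refine ⟨(L 0).prod (Measure.pi fun _ : Fin N => (ν : Measure (Euc d))), by simp, by simp, ?_⟩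
    rw [pow_zero, one_mul]
    refine le_add_right ?_
    calc _ ≤ ∫⁻ p, (((N : ℕ) : ℝ≥0∞)⁻¹ * ∑ i, ‖p.1 i‖ₑ + ((N : ℕ) : ℝ≥0∞)⁻¹ * ∑ i, ‖p.2 i‖ₑ)
          ∂((L 0).prod (Measure.pi fun _ : Fin N => (ν : Measure (Euc d)))) := by
          refine lintegral_mono fun p => ?_
          rw [← mul_add, ← Finset.sum_add_distrib]
          gcongr with i
          rw [edist_eq_enorm_sub]; exact enorm_sub_le
      _ = K := by
          rw [lintegral_add_left (by fun_prop), lintegral_prod _ (by fun_prop),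
            lintegral_prod _ (by fun_prop)]
          simp only [lintegral_const, measure_univ, mul_one]
          rw [hK, lintegral_pi_average N (ν : Measure (Euc d)) (g := fun x => ‖x‖ₑ) (by fun_prop)]
  | succ n ih =>
    obtain ⟨π, h₁, h₂, h₃⟩ := ih
    have hp : IsProbabilityMeasure π := by
      constructor
      rw [← Set.preimage_univ (f := Prod.snd), ← Measure.map_apply measurable_snd .univ, h₂,
        measure_univ]
    obtain ⟨π', h₁', h₂', h₃'⟩ := hG.exists_coupling_step N hν hfix h₂
    refine ⟨π', by rw [h₁', hL, h₁], h₂', h₃'.trans ?_⟩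
    have hb : b ≤ 1 := (le_add_self.trans_lt hG.add_lt_one).le
    -- The constant is the sum of the geometric series, so the recursion reproduces it.
    have hinv : (a + b) * (1 - (a + b))⁻¹ + 1 = (1 - (a + b))⁻¹ := by
      have h0 : 1 - (a + b) ≠ 0 := (tsub_pos_of_lt hG.add_lt_one).ne'
      have ht : 1 - (a + b) ≠ ∞ := ENNReal.sub_ne_top ENNReal.one_ne_top
      nth_rw 2 [← ENNReal.mul_inv_cancel h0 ht]
      rw [← add_mul, add_tsub_cancel_of_le hG.add_lt_one.le, one_mul]
    calc _ ≤ (a + b) * ((a + b) ^ n * K + (1 - (a + b))⁻¹ * β) + 1 * β := by gcongr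
      _ = (a + b) ^ (n + 1) * K + ((a + b) * (1 - (a + b))⁻¹ + 1) * β := by ring
      _ = _ := by rw [hinv]

end IsMeanContraction

/-! ### The given particle system follows the Markov dynamics. -/

namespace IsParticleSystem

variable {d m : ℕ} {A : Matrix (Fin d) (Fin d) ℝ} {δ : ℝ}
  {f : Euc d → ProbabilityMeasure (Euc d) → Euc m → Euc d} {θ : ProbabilityMeasure (Euc m)}
  {μ₀ : ProbabilityMeasure (Euc d)} {N : ℕ+} {Ω : Type*} [MeasurableSpace Ω] {P : Measure Ω}
  {X : ℕ → Fin N → Ω → Euc d} {ε : ℕ → Fin N → Ω → Euc m} {a b : ℝ≥0∞}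

theorem measurable_state (hX : IsParticleSystem A δ f θ μ₀ N P X ε)
    (hG : IsMeanContraction (stepMap A δ f) θ a b) (n : ℕ) : Measurable fun w i => X n i w := by
  induction n with
  | zero => exact measurable_pi_lambda _ hX.measurable_init
  | succ n ih =>
    have hε : Measurable fun w i => ε n i w := measurable_pi_lambda _ (hX.measurable_noise n)
    have h : (fun w i => X (n + 1) i w) =
        fun w => particleStep (stepMap A δ f) N (fun i => X n i w, fun i => ε n i w) := by
      funext w i; exact hX.step n i w
    rw [h]
    exact (hG.measurable_particleStep N).comp (ih.prodMk hε)

/-- Currying turns the family indexed by time and particle into an i.i.d. sequence of noise vectors.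
-/
theorem map_noise (hX : IsParticleSystem A δ f θ μ₀ N P X ε) :
    P.map (fun w n i => ε n i w) = Measure.infinitePi fun _ : ℕ =>
      Measure.pi fun _ : Fin N => (θ : Measure (Euc m)) := by
  have h := hX.indep_noise.map_fun_eq_infinitePi_map fun (p : ℕ × Fin N) => hX.measurable_noise p.1 p.2
  simp only [hX.law_noise] at h
  have hm : Measurable fun w (p : ℕ × Fin N) => ε p.1 p.2 w :=
    measurable_pi_lambda _ fun p => hX.measurable_noise p.1 p.2
  have hc := Measure.infinitePi_map_curry
    (fun (_ : ℕ) (_ : Fin N) => (θ : Measure (Euc m)))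
  rw [← h, Measure.map_map (MeasurableEquiv.measurable _) hm] at hc
  simp only [Measure.infinitePi_eq_pi] at hc
  exact hc

variable [IsProbabilityMeasure P]

/-- Induction on time: each step consumes one noise vector and leaves the later ones independent of
the new state. -/
theorem map_state_noise (hX : IsParticleSystem A δ f θ μ₀ N P X ε)
    (hG : IsMeanContraction (stepMap A δ f) θ a b) (n : ℕ) :
    P.map (fun w => (fun i => X n i w, fun k i => ε (k + n) i w)) =
      (P.map fun w i => X n i w).prod (Measure.infinitePi fun _ : ℕ =>
        Measure.pi fun _ : Fin N => (θ : Measure (Euc m))) := by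
  have hε : ∀ n, Measurable fun w k i => ε (k + n) i w := fun n =>
    measurable_pi_lambda _ fun k => measurable_pi_lambda _ fun i => hX.measurable_noise _ _
  induction n with
  | zero =>
    have hm : Measurable fun w (p : ℕ × Fin N) => ε p.1 p.2 w :=
      measurable_pi_lambda _ fun p => hX.measurable_noise p.1 p.2
    have hind := hX.indep_init_noise.comp measurable_id
      (MeasurableEquiv.curry ℕ (Fin N) (Euc m)).measurable
    have h := (indepFun_iff_map_prod_eq_prod_map_map (hX.measurable_state hG 0).aemeasurable
      (hε 0).aemeasurable).1 hind
    rw [h, ← hX.map_noise]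
    rfl
  | succ n ih =>
    have h := (map_update_noise P (Measure.pi fun _ : Fin N => (θ : Measure (Euc m)))
      (X' := fun w i => X (n + 1) i w) (Φ := particleStep (stepMap A δ f) N)
      (hX.measurable_state hG n) (hε n) (hG.measurable_particleStep N)
      (fun w => by funext i; simp only [zero_add]; exact hX.step n i w) ih).2
    rw [← h]
    simp only [add_right_comm _ 1 n, add_assoc]

theorem map_state_succ (hX : IsParticleSystem A δ f θ μ₀ N P X ε)
    (hG : IsMeanContraction (stepMap A δ f) θ a b) (n : ℕ) :
    P.map (fun w i => X (n + 1) i w) = ((P.map fun w i => X n i w).prod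
      (Measure.pi fun _ : Fin N => (θ : Measure (Euc m)))).map
        (particleStep (stepMap A δ f) N) :=
  (map_update_noise P (Measure.pi fun _ : Fin N => (θ : Measure (Euc m)))
    (X' := fun w i => X (n + 1) i w) (Φ := particleStep (stepMap A δ f) N)
    (hX.measurable_state hG n) (E := fun w k i => ε (k + n) i w)
    (measurable_pi_lambda _ fun k => measurable_pi_lambda _ fun i => hX.measurable_noise _ _)
    (hG.measurable_particleStep N)
    (fun w => by funext i; simp only [zero_add]; exact hX.step n i w)
    (hX.map_state_noise hG n)).1

/-- The particles are compared with the coupled i.i.d. sample, and the sample with `ν`; the second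
comparison accounts for the extra `+ 1`. -/
theorem meanDist_le (hX : IsParticleSystem A δ f θ μ₀ N P X ε)
    (hG : IsMeanContraction (stepMap A δ f) θ a b) {ν : ProbabilityMeasure (Euc d)}
    (hν : HasFirstMoment ν)
    (hfix : ((ν : Measure (Euc d)).prod (θ : Measure (Euc m))).map
      (fun p => stepMap A δ f p.1 ν p.2) = ν) (n : ℕ) :
    meanDist P X n ν ≤
      (a + b) ^ n * (∫⁻ x, ‖x‖ₑ ∂(μ₀ : Measure (Euc d)) + ∫⁻ x, ‖x‖ₑ ∂(ν : Measure (Euc d))) +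
        ((1 - (a + b))⁻¹ + 1) *
          ∫⁻ y, wasserstein1 (empirical N y : Measure (Euc d)) (ν : Measure (Euc d))
            ∂(Measure.pi fun _ : Fin N => (ν : Measure (Euc d))) := by
  set L : ℕ → Measure (Fin N → Euc d) := fun n => P.map fun w i => X n i w with hLdef
  have hL0 : IsProbabilityMeasure (L 0) :=
    Measure.isProbabilityMeasure_map (hX.measurable_state hG 0).aemeasurable
  have hinit : ∫⁻ x, ((N : ℕ) : ℝ≥0∞)⁻¹ * ∑ i, ‖x i‖ₑ ∂(L 0) =
      ∫⁻ x, ‖x‖ₑ ∂(μ₀ : Measure (Euc d)) := by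
    rw [hLdef, lintegral_map (by fun_prop) (hX.measurable_state hG 0),
      lintegral_const_mul' _ _ (inv_card_ne_top N),
      lintegral_finsetSum _ fun i _ => (hX.measurable_init i).enorm]
    have : ∀ i : Fin N, ∫⁻ w, ‖X 0 i w‖ₑ ∂P = ∫⁻ x, ‖x‖ₑ ∂(μ₀ : Measure (Euc d)) := fun i => by
      rw [← hX.law_init i, lintegral_map (by fun_prop) (hX.measurable_init i)]
    simp_rw [this]
    exact inv_card_mul_sum_const N _
  obtain ⟨π, h₁, h₂, h₃⟩ := hG.exists_coupling N hν hfix (L := L)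
    (fun n => hX.map_state_succ hG n) n
  rw [hinit] at h₃
  have hw := measurable_wasserstein1_empirical N ν
  have hav : Measurable fun p : (Fin N → Euc d) × (Fin N → Euc d) =>
      ((N : ℕ) : ℝ≥0∞)⁻¹ * ∑ i, edist (p.1 i) (p.2 i) := by fun_prop
  calc meanDist P X n ν
      = ∫⁻ x, wasserstein1 (empirical N x : Measure (Euc d)) (ν : Measure (Euc d)) ∂(L n) := by
        rw [hLdef, lintegral_map hw (hX.measurable_state hG n), meanDist]
    _ = ∫⁻ p, wasserstein1 (empirical N p.1 : Measure (Euc d)) (ν : Measure (Euc d)) ∂π := by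
        rw [← h₁, lintegral_map hw measurable_fst]
    _ ≤ ∫⁻ p, (((N : ℕ) : ℝ≥0∞)⁻¹ * ∑ i, edist (p.1 i) (p.2 i) +
          wasserstein1 (empirical N p.2 : Measure (Euc d)) (ν : Measure (Euc d))) ∂π :=
        lintegral_mono fun p => wasserstein1_empirical_left_le N p.1 p.2 ν
    _ = ∫⁻ p, ((N : ℕ) : ℝ≥0∞)⁻¹ * ∑ i, edist (p.1 i) (p.2 i) ∂π +
          ∫⁻ y, wasserstein1 (empirical N y : Measure (Euc d)) (ν : Measure (Euc d))
            ∂(Measure.pi fun _ : Fin N => (ν : Measure (Euc d))) := by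
        rw [lintegral_add_left hav, ← h₂, lintegral_map hw measurable_snd]
    _ ≤ _ := by
        refine (add_le_add_left h₃ _).trans (le_of_eq ?_)
        ring

end IsParticleSystem

/-! ### The concrete dynamics as a mean contraction. -/

section StepMap

variable {d m : ℕ} {A : Matrix (Fin d) (Fin d) ℝ} {δ : ℝ}
  {f : Euc d → ProbabilityMeasure (Euc d) → Euc m → Euc d} {θ : ProbabilityMeasure (Euc m)}

theorem lintegral_lt_top_of_lintegral_rpow_lt_top {Ω : Type*} [MeasurableSpace Ω] {P : Measure Ω}
    [IsFiniteMeasure P] {g : Ω → ℝ≥0∞} {α : ℝ} (hα : 0 < α) (h : ∫⁻ w, g w ^ (1 + α) ∂P < ∞) :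
    ∫⁻ w, g w ∂P < ∞ := by
  calc ∫⁻ w, g w ∂P ≤ ∫⁻ w, (1 + g w ^ (1 + α)) ∂P := by
        refine lintegral_mono fun w => ?_
        rcases le_total (g w) 1 with h1 | h1
        · exact h1.trans le_self_add
        · refine le_trans ?_ le_add_self
          calc g w = g w ^ (1 : ℝ) := (ENNReal.rpow_one _).symm
            _ ≤ g w ^ (1 + α) := ENNReal.rpow_le_rpow_of_exponent_le h1 (by linarith)
    _ = P Set.univ + ∫⁻ w, g w ^ (1 + α) ∂P := by
        rw [lintegral_add_left measurable_const, lintegral_one]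
    _ < ∞ := ENNReal.add_lt_top.2 ⟨measure_lt_top _ _, h⟩

theorem measurable_stepMap
    (hf : Measurable fun p : Euc d × ProbabilityMeasure (Euc d) × Euc m => f p.1 p.2.1 p.2.2) :
    Measurable fun p : Euc d × ProbabilityMeasure (Euc d) × Euc m =>
      stepMap A δ f p.1 p.2.1 p.2.2 :=
  ((Matrix.toEuclideanCLM (𝕜 := ℝ) A).measurable.comp measurable_fst).add (hf.const_smul δ)

theorem bind_map_eq_map_prod {α β γ : Type*} [MeasurableSpace α] [MeasurableSpace β]
    [MeasurableSpace γ] {μ : Measure α} {θ : Measure β} [SFinite θ] {g : α → β → γ}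
    (hg : Measurable fun p : α × β => g p.1 p.2) :
    (μ.bind fun x => θ.map (g x)) = (μ.prod θ).map fun p => g p.1 p.2 := by
  have hx : ∀ x, Measurable (g x) := fun x => hg.comp measurable_prodMk_left
  have ht : Measurable fun x => θ.map (g x) := by
    refine Measure.measurable_of_measurable_coe _ fun s hs => ?_
    simp only [Measure.map_apply (hx _) hs]
    exact measurable_measure_prodMk_left (hg hs)
  ext s hs
  rw [Measure.bind_apply hs ht.aemeasurable, Measure.map_apply hg hs, Measure.prod_apply (hg hs)]
  exact lintegral_congr fun x => Measure.map_apply (hx x) hs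

theorem nonlinearMap_eq_map_prod
    (hf : Measurable fun p : Euc d × ProbabilityMeasure (Euc d) × Euc m => f p.1 p.2.1 p.2.2)
    (μ : ProbabilityMeasure (Euc d)) :
    nonlinearMap A δ f θ μ = ((μ : Measure (Euc d)).prod (θ : Measure (Euc m))).map
      fun p => stepMap A δ f p.1 μ p.2 := by
  have hstep := measurable_stepMap (A := A) (δ := δ) hf
  unfold nonlinearMap transition
  generalize stepMap A δ f = G at hstep ⊢
  exact bind_map_eq_map_prod (g := fun x z => G x μ z)
    (hstep.comp (measurable_fst.prodMk (measurable_const.prodMk measurable_snd)))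

/-- The constant `δσ` enters once through the state, next to `e^{-ω}`, and once through the law;
this is the origin of the factor 2 in `threshold`. -/
theorem isMeanContraction_stepMap
    (hf : Measurable fun p : Euc d × ProbabilityMeasure (Euc d) × Euc m => f p.1 p.2.1 p.2.2)
    {ω : ℝ} (hA : ‖Matrix.toEuclideanCLM (𝕜 := ℝ) A‖ ≤ Real.exp (-ω))
    (hD₁ : ∫⁻ z, originBound f z ∂(θ : Measure (Euc m)) < ∞) (hδ : 0 < δ)
    (hδ' : ENNReal.ofReal δ < threshold f θ ω) :
    IsMeanContraction (stepMap A δ f) θ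
      (ENNReal.ofReal (Real.exp (-ω)) +
        ENNReal.ofReal δ * ∫⁻ z, lipBound f z ∂(θ : Measure (Euc m)))
      (ENNReal.ofReal δ * ∫⁻ z, lipBound f z ∂(θ : Measure (Euc m))) := by
  set σ := ∫⁻ z, lipBound f z ∂(θ : Measure (Euc m)) with hσdef
  -- An infinite `σ` would make the threshold 0.
  have hσ : σ ≠ ∞ := by
    intro h
    rw [threshold, ← hσdef, h, ENNReal.mul_top two_ne_zero, ENNReal.div_top] at hδ'
    exact not_lt_zero hδ'
  have hδn : ‖δ‖ₑ = ENNReal.ofReal δ := Real.enorm_of_nonneg hδ.le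
  refine ⟨measurable_stepMap hf, fun x₁ x₂ μ₁ μ₂ h₁ h₂ => ?_, ?_, ?_⟩
  · have m₁ := measurable_apply_noise hf x₁ μ₁
    have m₂ := measurable_apply_noise hf x₂ μ₂
    have hlin : ‖Matrix.toEuclideanCLM (𝕜 := ℝ) A (x₁ - x₂)‖ₑ ≤
        ENNReal.ofReal (Real.exp (-ω)) * edist x₁ x₂ := by
      rw [edist_eq_enorm_sub, ← ofReal_norm, ← ofReal_norm, ← ENNReal.ofReal_mul (by positivity)]
      refine ENNReal.ofReal_le_ofReal ((ContinuousLinearMap.le_opNorm _ _).trans ?_)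
      gcongr
    calc ∫⁻ z, edist (stepMap A δ f x₁ μ₁ z) (stepMap A δ f x₂ μ₂ z) ∂(θ : Measure (Euc m))
        ≤ ∫⁻ z, (ENNReal.ofReal (Real.exp (-ω)) * edist x₁ x₂ +
            ENNReal.ofReal δ * ‖f x₁ μ₁ z - f x₂ μ₂ z‖ₑ) ∂(θ : Measure (Euc m)) := by
          refine lintegral_mono fun z => ?_
          have e : stepMap A δ f x₁ μ₁ z - stepMap A δ f x₂ μ₂ z =
              Matrix.toEuclideanCLM (𝕜 := ℝ) A (x₁ - x₂) + δ • (f x₁ μ₁ z - f x₂ μ₂ z) := by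
            rw [stepMap, stepMap, map_sub, smul_sub]; abel
          rw [edist_eq_enorm_sub, e]
          refine (enorm_add_le _ _).trans (add_le_add hlin ?_)
          rw [enorm_smul, hδn]
      _ = ENNReal.ofReal (Real.exp (-ω)) * edist x₁ x₂ + ENNReal.ofReal δ *
            ∫⁻ z, ‖f x₁ μ₁ z - f x₂ μ₂ z‖ₑ ∂(θ : Measure (Euc m)) := by
          rw [lintegral_add_left measurable_const, lintegral_const, measure_univ, mul_one,
            lintegral_const_mul' _ _ ENNReal.ofReal_ne_top]
      _ ≤ ENNReal.ofReal (Real.exp (-ω)) * edist x₁ x₂ + ENNReal.ofReal δ * (σ *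
            (edist x₁ x₂ + wasserstein1 (μ₁ : Measure (Euc d)) (μ₂ : Measure (Euc d)))) := by
          gcongr; exact lintegral_enorm_sub_le hf hσ x₁ x₂ h₁ h₂
      _ = _ := by ring
  · have e : ∀ z, ‖stepMap A δ f 0 (diracZero d) z‖ₑ = ENNReal.ofReal δ * originBound f z :=
      fun z => by rw [stepMap, map_zero, zero_add, enorm_smul, hδn, originBound]
    simp_rw [e]
    rw [lintegral_const_mul' _ _ ENNReal.ofReal_ne_top]
    exact ENNReal.mul_lt_top ENNReal.ofReal_lt_top hD₁
  · rw [threshold, ENNReal.lt_div_iff_mul_lt (Or.inr ENNReal.ofReal_ne_top)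
      (Or.inl (ENNReal.mul_ne_top ENNReal.ofNat_ne_top hσ)),
      ENNReal.ofReal_sub _ (Real.exp_pos _).le, ENNReal.ofReal_one, lt_tsub_iff_right] at hδ'
    refine lt_of_eq_of_lt ?_ hδ'
    ring

end StepMap

/-! ### The main theorem. -/

theorem corollary3p5 {d m : ℕ} (A : Matrix (Fin d) (Fin d) ℝ) (δ : ℝ)
    (f : Euc d → ProbabilityMeasure (Euc d) → Euc m → Euc d)
    (hf : Measurable fun p : Euc d × ProbabilityMeasure (Euc d) × Euc m => f p.1 p.2.1 p.2.2)
    (θ : ProbabilityMeasure (Euc m)) (μ₀ : ProbabilityMeasure (Euc d))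
    (Ω : ℕ+ → Type*) [∀ N, MeasurableSpace (Ω N)]
    (P : ∀ N, Measure (Ω N)) [∀ N, IsProbabilityMeasure (P N)]
    (X : ∀ N : ℕ+, ℕ → Fin N → Ω N → Euc d) (ε : ∀ N : ℕ+, ℕ → Fin N → Ω N → Euc m)
    (hX : ∀ N, IsParticleSystem A δ f θ μ₀ N (P N) (X N) (ε N))
    -- the linear part is a contraction
    (ω : ℝ) (hω : 0 < ω) (hA : ‖Matrix.toEuclideanCLM (𝕜 := ℝ) A‖ ≤ Real.exp (-ω))
    -- moments of order `1 + α`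
    (α : ℝ) (hα : 0 < α)
    (hμ₀ : ∫⁻ x, ‖x‖ₑ ^ (1 + α) ∂(μ₀ : Measure (Euc d)) < ∞)
    (hD : ∫⁻ z, lipBound f z ^ (1 + α) ∂(θ : Measure (Euc m)) < ∞)
    (hD₁ : ∫⁻ z, originBound f z ^ (1 + α) ∂(θ : Measure (Euc m)) < ∞)
    (hδ : 0 < δ) (hδ' : ENNReal.ofReal δ < threshold f θ ω) :
    ∃ μ_inf : ProbabilityMeasure (Euc d),
      IsFixedLaw A δ f θ μ_inf ∧
      (∀ ν : ProbabilityMeasure (Euc d), IsFixedLaw A δ f θ ν → ν = μ_inf) ∧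
      limsup (fun N : ℕ+ => limsup (fun n : ℕ => meanDist (P N) (X N) n μ_inf) atTop) atTop = 0 ∧
      limsup (fun n : ℕ => limsup (fun N : ℕ+ => meanDist (P N) (X N) n μ_inf) atTop) atTop = 0 := by
  have hG := isMeanContraction_stepMap (A := A) hf hA
    (lintegral_lt_top_of_lintegral_rpow_lt_top hα hD₁) hδ hδ'
  obtain ⟨ν, hν, hfix⟩ := hG.exists_next_eq
  refine ⟨ν, ⟨hν, by rw [nonlinearMap_eq_map_prod hf, hfix]⟩, fun ν' hν' => ?_, ?_⟩
  · exact hG.eq_of_next_eq hν'.1 hν (by rw [← nonlinearMap_eq_map_prod hf, hν'.2]) hfix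
  set γ := ENNReal.ofReal (Real.exp (-ω)) +
    ENNReal.ofReal δ * ∫⁻ z, lipBound f z ∂(θ : Measure (Euc m)) +
    ENNReal.ofReal δ * ∫⁻ z, lipBound f z ∂(θ : Measure (Euc m))
  set K := ∫⁻ x, ‖x‖ₑ ∂(μ₀ : Measure (Euc d)) + ∫⁻ x, ‖x‖ₑ ∂(ν : Measure (Euc d))
  set β : ℕ+ → ℝ≥0∞ := fun N => ((1 - γ)⁻¹ + 1) *
    ∫⁻ y, wasserstein1 (empirical N y : Measure (Euc d)) (ν : Measure (Euc d))
      ∂(Measure.pi fun _ : Fin N => (ν : Measure (Euc d))) with hβdef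
  have hγ : γ < 1 := hG.add_lt_one
  have hK : K ≠ ∞ := ENNReal.add_ne_top.2
    ⟨(lintegral_lt_top_of_lintegral_rpow_lt_top hα hμ₀).ne, hν.ne⟩
  -- Time and particle number occur in separate terms, so the limits may be taken in either order.
  have hle : ∀ N n, meanDist (P N) (X N) n ν ≤ γ ^ n * K + β N := fun N n =>
    (hX N).meanDist_le hG hν hfix n
  have hβ : Tendsto β atTop (nhds 0) := by
    have h := ENNReal.Tendsto.const_mul (a := (1 - γ)⁻¹ + 1)
      (tendsto_lintegral_wasserstein1_empirical ν hν) (Or.inr (ENNReal.add_ne_top.2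
        ⟨ENNReal.inv_ne_top.2 (tsub_pos_of_lt hγ).ne', ENNReal.one_ne_top⟩))
    rwa [mul_zero] at h
  have hpow : Tendsto (fun n : ℕ => γ ^ n * K) atTop (nhds 0) := by
    have h := ENNReal.Tendsto.mul_const (b := K)
      (ENNReal.tendsto_pow_atTop_nhds_zero_of_lt_one hγ) (Or.inr hK)
    rwa [zero_mul] at h
  constructor
  · refine le_antisymm ?_ zero_le
    calc _ ≤ limsup β atTop := by
          refine limsup_le_limsup (Eventually.of_forall fun N => ?_)
          have h := hpow.add_const (β N)
          rw [zero_add] at h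
          exact (limsup_le_limsup (Eventually.of_forall (hle N))).trans h.limsup_eq.le
      _ = 0 := hβ.limsup_eq
  · refine le_antisymm ?_ zero_le
    calc _ ≤ limsup (fun n : ℕ => γ ^ n * K) atTop := by
          refine limsup_le_limsup (Eventually.of_forall fun n => ?_)
          have h := hβ.const_add (γ ^ n * K)
          rw [add_zero] at h
          exact (limsup_le_limsup (Eventually.of_forall fun N => hle N n)).trans h.limsup_eq.le
      _ = 0 := hpow.limsup_eq
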